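/- A $k$-graph is a $k$-uniform hypergraph. For integers $l\ge k\ge 3$ let $H_{l+1}^{(k)}$ be the $k$-graph obtained from the complete graph $K_{l+1}$ by enlarging each edge with its own set of $k-2$ new vertices (the new sets are pairwise disjoint and disjoint from the vertices of $K_{l+1}$), and let $T^{(k)}(n,l)$ be the $k$-graph obtained by partitioning $\{1,\dots,n\}$ into $l$ parts of sizes $\lfloor n/l\rfloor$ and $\lceil n/l\rceil$ and taking as edges all $k$-sets that meet every part in at most one vertex. A $k$-graph is $F$-free if it has no (not necessarily induced) subgraph isomorphic to $F$; $|G|$ is the number of edges of $G$; and $\mathrm{ex}(n,F)$ is the maximum of $|G|$ over all $F$-free $k$-graphs $G$ on $n$ vertices. Theorem. For all $l\ge k\ge 3$ there is $n_0=n_0(l,k)$ such that for every $n\ge n_0$ we have $\mathrm{ex}(n,H_{l+1}^{(k)})=|T^{(k)}(n,l)|$, and $T^{(k)}(n,l)$ is, up to isomorphism, the unique maximum $H_{l+1}^{(k)}$-free $k$-graph on $n$ vertices. -/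

import Mathlib

/-- A `k`-uniform hypergraph (`k`-graph) on the vertex set `V`, given by its finite set of edges,
each of which is a set of exactly `k` vertices. -/
structure KGraph (V : Type*) (k : ℕ) where
  edges : Finset (Finset V)
  sized : (edges : Set (Finset V)).Sized k

namespace KGraph

/-- The size `|G|` of a `k`-graph: its number of edges. -/
def size {V : Type*} {k : ℕ} (G : KGraph V k) : ℕ := G.edges.card

/-- `G` has a (not necessarily induced) subgraph isomorphic to `F`. -/
def Contains {V W : Type*} {k : ℕ} (G : KGraph V k) (F : KGraph W k) : Prop :=
  ∃ f : W ↪ V, ∀ e ∈ F.edges, e.map f ∈ G.edges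

/-- `G` is `F`-free. -/
def Free {V W : Type*} {k : ℕ} (G : KGraph V k) (F : KGraph W k) : Prop :=
  ¬ G.Contains F

/-- Two `k`-graphs are isomorphic: some bijection of the vertex sets carries edges to edges
and non-edges to non-edges. -/
def Isomorphic {V W : Type*} {k : ℕ} (G : KGraph V k) (F : KGraph W k) : Prop :=
  ∃ σ : V ≃ W, ∀ e : Finset V, e ∈ G.edges ↔ e.map σ.toEmbedding ∈ F.edges

/-- The Turán function `ex(n, F)`: the maximum size of an `F`-free `k`-graph on `n` vertices. -/
noncomputable def ex {W : Type*} {k : ℕ} (n : ℕ) (F : KGraph W k) : ℕ :=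
  sSup {m : ℕ | ∃ G : KGraph (Fin n) k, G.Free F ∧ G.size = m}

/-- `G` is a maximum `F`-free `k`-graph among the `k`-graphs on its vertex set. -/
def IsMaximumFree {V W : Type*} {k : ℕ} (G : KGraph V k) (F : KGraph W k) : Prop :=
  G.Free F ∧ ∀ G' : KGraph V k, G'.Free F → G'.size ≤ G.size

/-- The edges of the complete `2`-graph on `l` vertices. -/
abbrev Pair (l : ℕ) : Type := {p : Finset (Fin l) // p.card = 2}

/-- The vertices of the expanded complete `2`-graph: the `l` core vertices, and for every pair
of core vertices `k - 2` new vertices of its own. -/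
abbrev ExpandedVertex (k l : ℕ) : Type := Fin l ⊕ (Pair l × Fin (k - 2))

/-- The `k`-set obtained from the pair `p` of core vertices by adding its `k - 2` new vertices. -/
def expandedEdge (k l : ℕ) (p : Pair l) : Finset (ExpandedVertex k l) :=
  p.1.disjSum ({p} ×ˢ Finset.univ)

/-- The `k`-graph `H_l^{(k)}`, obtained from the complete `2`-graph on `l` vertices by enlarging
each edge with a new set of `k - 2` vertices. -/
def expandedComplete (k l : ℕ) (hk : 2 ≤ k) : KGraph (ExpandedVertex k l) k where
  edges := Finset.univ.image (expandedEdge k l)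
  sized := by
    intro e he
    obtain ⟨p, -, rfl⟩ := Finset.mem_image.1 (Finset.mem_coe.1 he)
    simp [expandedEdge, p.2]
    omega

/-- The `k`-graph `T^{(k)}(n, l)`: the `n` vertices are partitioned into the `l` residue classes
modulo `l`, whose sizes are `⌊n / l⌋` or `⌈n / l⌉`, and the edges are all the `k`-sets that meet
every class in at most one vertex. -/
def turan (k n l : ℕ) : KGraph (Fin n) k where
  edges := (Finset.powersetCard k Finset.univ).filter
    fun e => ∀ x ∈ e, ∀ y ∈ e, x.val % l = y.val % l → x = y
  sized := by
    intro e he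
    exact (Finset.mem_powersetCard.1 (Finset.mem_filter.1 (Finset.mem_coe.1 he)).1).2

end KGraph

section CliqueCounting

open Finset

open scoped Classical in
/-- The cliques of `Γ` on `s` vertices. -/
noncomputable def SimpleGraph.cliques {V : Type*} [Fintype V] (Γ : SimpleGraph V) (s : ℕ) :
    Finset (Finset V) :=
  univ.filter fun Q => Γ.IsNClique s Q

open scoped Classical in
/-- The vertices adjacent to every vertex of `Q`. -/
noncomputable def SimpleGraph.extenders {V : Type*} [Fintype V] (Γ : SimpleGraph V)
    (Q : Finset V) : Finset V :=
  univ.filter fun v => ∀ q ∈ Q, Γ.Adj v q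

namespace SimpleGraph

variable {V : Type*} [Fintype V] (Γ : SimpleGraph V)

theorem mem_cliques {s : ℕ} {Q : Finset V} : Q ∈ Γ.cliques s ↔ Γ.IsNClique s Q := by
  simp [cliques]

theorem mem_extenders {Q : Finset V} {v : V} : v ∈ Γ.extenders Q ↔ ∀ q ∈ Q, Γ.Adj v q := by
  simp [extenders]

theorem notMem_of_mem_extenders {Q : Finset V} {v : V} (h : v ∈ Γ.extenders Q) : v ∉ Q :=
  fun hv => Γ.loopless.irrefl v (Γ.mem_extenders.1 h v hv)

variable [DecidableEq V]

theorem sum_cliques_erase (s : ℕ) (φ : Finset V → ℝ) :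
    ∑ A ∈ Γ.cliques (s + 1), ∑ a ∈ A, φ (A.erase a) =
      ∑ Q ∈ Γ.cliques s, ((Γ.extenders Q).card : ℝ) * φ Q := by
  simp_rw [← nsmul_eq_mul, ← sum_const]
  rw [sum_sigma', sum_sigma']
  refine sum_bij' (fun p _ => ⟨p.1.erase p.2, p.2⟩) (fun p _ => ⟨insert p.2 p.1, p.2⟩)
    ?_ ?_ ?_ ?_ ?_
  · rintro ⟨A, a⟩ h
    simp only [mem_sigma, mem_cliques, mem_extenders] at h ⊢
    refine ⟨by simpa using h.1.erase_of_mem h.2, fun q hq => ?_⟩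
    rw [mem_erase] at hq
    exact h.1.isClique h.2 hq.2 (Ne.symm hq.1)
  · rintro ⟨Q, v⟩ h
    simp only [mem_sigma, mem_cliques, mem_extenders] at h ⊢
    exact ⟨h.1.insert h.2, mem_insert_self _ _⟩
  · rintro ⟨A, a⟩ h
    simp only [mem_sigma] at h
    simp [insert_erase h.2]
  · rintro ⟨Q, v⟩ h
    simp only [mem_sigma] at h
    simp [erase_insert (Γ.notMem_of_mem_extenders h.2)]
  · rintro ⟨A, a⟩ h
    rfl

theorem card_cliques_succ_mul (s : ℕ) :
    ((Γ.cliques (s + 1)).card : ℝ) * (s + 1) = ∑ Q ∈ Γ.cliques s, ((Γ.extenders Q).card : ℝ) := by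
  have := Γ.sum_cliques_erase s (fun _ => 1)
  simp only [mul_one, sum_const, nsmul_eq_mul] at this
  rw [← this, ← nsmul_eq_mul, ← sum_const]
  refine sum_congr rfl fun A hA => ?_
  rw [(Γ.mem_cliques.1 hA).card_eq]
  push_cast
  ring

theorem sum_extenders_erase_le {s : ℕ} {A : Finset V} (hA : A.card = s + 2) :
    ∑ a ∈ A, ((Γ.extenders (A.erase a)).card : ℝ) ≤
      Fintype.card V + (s + 1) * (Γ.extenders A).card := by
  have key : ∀ v : V, (A.filter fun a => v ∈ Γ.extenders (A.erase a)).card ≤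
      1 + (s + 1) * (if v ∈ Γ.extenders A then 1 else 0) := by
    intro v
    split_ifs with hv
    · exact (card_filter_le _ _).trans (by omega)
    · rw [mul_zero, add_zero, card_le_one]
      intro a ha b hb
      by_contra hab
      simp only [mem_filter, mem_extenders, mem_erase] at ha hb
      refine hv (Γ.mem_extenders.2 fun q hq => ?_)
      by_cases h : q = a
      · exact hb.2 q ⟨fun h' => hab (h.symm.trans h'), hq⟩
      · exact ha.2 q ⟨h, hq⟩
  have h1 : ∑ a ∈ A, (Γ.extenders (A.erase a)).card =
      ∑ v : V, (A.filter fun a => v ∈ Γ.extenders (A.erase a)).card := by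
    simp_rw [card_filter]
    rw [sum_comm]
    refine sum_congr rfl fun a _ => ?_
    rw [← card_filter]
    congr 1
    ext v
    simp
  have h2 : ∑ a ∈ A, (Γ.extenders (A.erase a)).card ≤
      Fintype.card V + (s + 1) * (Γ.extenders A).card := by
    rw [h1]
    refine (sum_le_sum fun v _ => key v).trans ?_
    rw [sum_add_distrib, ← mul_sum, ← card_filter]
    simp
  exact_mod_cast h2

/-- The Moon–Moser inequality. -/
theorem moon_moser (s : ℕ) :
    ((s + 2 : ℝ) * (Γ.cliques (s + 2)).card) ^ 2 ≤ (Γ.cliques (s + 1)).card *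
      (Fintype.card V * (Γ.cliques (s + 2)).card +
        (s + 1) * (s + 3) * (Γ.cliques (s + 3)).card) := by
  have h1 := Γ.card_cliques_succ_mul (s + 1)
  have h2 := Γ.card_cliques_succ_mul (s + 2)
  have h3 := Γ.sum_cliques_erase (s + 1) (fun Q => ((Γ.extenders Q).card : ℝ))
  have h4 : ∑ A ∈ Γ.cliques (s + 2), ∑ a ∈ A, ((Γ.extenders (A.erase a)).card : ℝ) ≤
      ∑ A ∈ Γ.cliques (s + 2), (Fintype.card V + (s + 1) * ((Γ.extenders A).card : ℝ)) :=
    sum_le_sum fun A hA => Γ.sum_extenders_erase_le (Γ.mem_cliques.1 hA).card_eq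
  rw [h3, sum_add_distrib, ← mul_sum, ← h2, sum_const, nsmul_eq_mul] at h4
  have h5 := sq_sum_le_card_mul_sum_sq (s := Γ.cliques (s + 1))
    (f := fun Q => ((Γ.extenders Q).card : ℝ))
  rw [← h1] at h5
  push_cast at h4 h5
  calc _ = (((Γ.cliques (s + 2)).card : ℝ) * (s + 1 + 1)) ^ 2 := by ring
    _ ≤ _ := h5
    _ ≤ _ := by
      refine mul_le_mul_of_nonneg_left ?_ (Nat.cast_nonneg _)
      simp_rw [pow_two]
      refine h4.trans (le_of_eq ?_)
      ring

variable {Γ}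

theorem card_cliques_ratio {l : ℕ} (hΓ : Γ.CliqueFree (l + 1)) {s : ℕ} (hs : s + 1 ≤ l) :
    ((Γ.cliques (s + 2)).card : ℝ) * (s + 2) * l ≤
      (l - s - 1) * Fintype.card V * (Γ.cliques (s + 1)).card := by
  obtain ⟨j, rfl⟩ := Nat.exists_eq_add_of_le hs
  clear hs
  induction j generalizing s with
  | zero =>
    have : Γ.cliques (s + 2) = ∅ :=
      eq_empty_of_forall_notMem fun Q hQ => hΓ Q (Γ.mem_cliques.1 hQ)
    rw [this]
    simp
  | succ j ih =>
    have h1 := Γ.moon_moser s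
    have h2 := ih (s := s + 1) (by convert hΓ using 1; ring)
    rcases (Γ.cliques (s + 2)).card.eq_zero_or_pos with h0 | h0
    · rw [h0]
      push_cast
      rw [zero_mul, zero_mul]
      have : (0 : ℝ) ≤ (s + 1 + (j + 1) - s - 1 : ℝ) := by
        have := Nat.cast_nonneg (α := ℝ) j
        linarith
      positivity
    · have h0' : (0 : ℝ) < (Γ.cliques (s + 2)).card := by exact_mod_cast h0
      have e : s + 1 + 2 = s + 3 := rfl
      have e' : s + 1 + 1 = s + 2 := rfl
      rw [e, e'] at h2
      push_cast at h2 ⊢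
      generalize ((Γ.cliques (s + 2)).card : ℝ) = a at *
      generalize ((Γ.cliques (s + 3)).card : ℝ) = b at *
      have hc : (0 : ℝ) ≤ (Γ.cliques (s + 1)).card := Nat.cast_nonneg _
      generalize ((Γ.cliques (s + 1)).card : ℝ) = c at *
      generalize (Fintype.card V : ℝ) = n at *
      have hs : (0 : ℝ) ≤ s := Nat.cast_nonneg _
      have hj : (0 : ℝ) ≤ j := Nat.cast_nonneg _
      generalize (s : ℝ) = s at *
      generalize (j : ℝ) = j at *
      have hp : 0 < (s + 2) * a := by positivity
      refine le_of_mul_le_mul_left ?_ hp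
      have h3 := mul_le_mul_of_nonneg_left h2 (mul_nonneg hc (by linarith : 0 ≤ s + 1))
      have h4 := mul_le_mul_of_nonneg_right h1 (by linarith : 0 ≤ s + j + 2)
      nlinarith [h3, h4]

/-- Fisher–Ryan type comparison of the clique counts in a graph of bounded clique number. -/
theorem card_cliques_le_card_edges {l : ℕ} (hΓ : Γ.CliqueFree (l + 1)) {r : ℕ} (hr : r + 2 ≤ l) :
    ((Γ.cliques (r + 2)).card : ℝ) * l.choose 2 * l ^ r ≤
      l.choose (r + 2) * Fintype.card V ^ r * (Γ.cliques 2).card := by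
  induction r with
  | zero => simp [mul_comm]
  | succ r ih =>
    have h1 := ih (by omega)
    have h2 := card_cliques_ratio hΓ (s := r + 1) (by omega)
    have h3 : (l.choose (r + 3) : ℝ) * (r + 3) = l.choose (r + 2) * (l - (r + 2)) := by
      have := Nat.choose_succ_right_eq l (r + 2)
      rw [← Nat.cast_inj (R := ℝ)] at this
      push_cast [Nat.cast_sub (show r + 2 ≤ l by omega)] at this
      linarith
    have hl : (r : ℝ) + 3 ≤ l := by exact_mod_cast hr
    have e : r + 1 + 2 = r + 3 := rfl
    have e' : r + 1 + 1 = r + 2 := rfl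
    rw [e, e'] at h2
    rw [e]
    push_cast at h2
    refine le_of_mul_le_mul_left ?_ (show (0 : ℝ) < r + 3 by positivity)
    calc _ = ((Γ.cliques (r + 3)).card * (r + 1 + 2) * l : ℝ) * (l.choose 2 * l ^ r) := by ring
      _ ≤ (l - (r + 1) - 1) * Fintype.card V * (Γ.cliques (r + 2)).card *
          (l.choose 2 * l ^ r) := mul_le_mul_of_nonneg_right h2 (by positivity)
      _ = (l - (r + 2)) * Fintype.card V *
          ((Γ.cliques (r + 2)).card * l.choose 2 * l ^ r) := by ring
      _ ≤ (l - (r + 2)) * Fintype.card V *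
          (l.choose (r + 2) * Fintype.card V ^ r * (Γ.cliques 2).card) :=
        mul_le_mul_of_nonneg_left h1 (mul_nonneg (by linarith) (by positivity))
      _ = (l.choose (r + 2) * (l - (r + 2))) * Fintype.card V ^ (r + 1) *
          (Γ.cliques 2).card := by ring
      _ = _ := by rw [← h3]; ring

open scoped Classical in
theorem card_adj_pairs (Γ : SimpleGraph V) :
    (univ.filter fun p : V × V => Γ.Adj p.1 p.2).card = 2 * (Γ.cliques 2).card := by
  have h1 := Γ.card_cliques_succ_mul 1
  have h2 : Γ.cliques 1 = univ.map ⟨fun v : V => ({v} : Finset V), singleton_injective⟩ := by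
    ext Q
    simp [mem_cliques, isNClique_one, eq_comm]
  rw [h2, sum_map] at h1
  have h3 : (univ.filter fun p : V × V => Γ.Adj p.1 p.2).card =
      ∑ v : V, (Γ.extenders {v}).card := by
    rw [card_filter, ← univ_product_univ, sum_product]
    refine sum_congr rfl fun v _ => ?_
    rw [← card_filter]
    congr 1
    ext w
    simp [mem_extenders, adj_comm]
  rw [h3, ← Nat.cast_inj (R := ℝ)]
  push_cast
  simp only [Function.Embedding.coeFn_mk] at h1
  rw [← h1]
  push_cast
  ring

open scoped Classical in
/-- Füredi's greedy partition of a graph without cliques on `l + 1` vertices: adjacent pairs plus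
inner adjacent pairs are at most the cross pairs. -/
theorem exists_greedy_partition {V : Type*} (Γ : SimpleGraph V) (l : ℕ) (S : Finset V)
    (h : ∀ Q ⊆ S, ¬ Γ.IsNClique (l + 1) Q) :
    ∃ f : V → ℕ, (∀ x ∈ S, f x < l) ∧
      (∑ x ∈ S, ∑ y ∈ S, if Γ.Adj x y then 1 else 0) +
      (∑ x ∈ S, ∑ y ∈ S, if Γ.Adj x y ∧ f x = f y then 1 else 0) ≤
      ∑ x ∈ S, ∑ y ∈ S, if f x ≠ f y then 1 else 0 := by
  induction l generalizing S with
  | zero =>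
    have : S = ∅ := by
      by_contra hS
      obtain ⟨x, hx⟩ := nonempty_iff_ne_empty.2 hS
      exact h {x} (by simpa using hx) (by simp)
    subst this
    exact ⟨fun _ => 0, by simp⟩
  | succ l ih =>
    rcases S.eq_empty_or_nonempty with rfl | hS
    · exact ⟨fun _ => 0, by simp⟩
    obtain ⟨x, hx, hmax⟩ := exists_max_image S (fun v => (S.filter fun w => Γ.Adj v w).card) hS
    obtain ⟨f, hf, hle⟩ := ih (S.filter fun w => Γ.Adj x w) (by
      intro Q hQ hc
      refine h (insert x Q) (insert_subset hx (hQ.trans (filter_subset _ _))) (hc.insert ?_)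
      exact fun b hb => (mem_filter.1 (hQ hb)).2)
    set A := S.filter fun w => Γ.Adj x w with hA
    set B := S.filter fun w => ¬ Γ.Adj x w with hB
    have hAB : ∀ v ∈ B, v ∉ A := fun v hv hv' => (mem_filter.1 hv).2 (mem_filter.1 hv').2
    have split : ∀ φ : V → V → ℕ, ∑ x ∈ S, ∑ y ∈ S, φ x y =
        ((∑ x ∈ A, ∑ y ∈ A, φ x y) + ∑ x ∈ A, ∑ y ∈ B, φ x y) +
        ((∑ x ∈ B, ∑ y ∈ A, φ x y) + ∑ x ∈ B, ∑ y ∈ B, φ x y) := by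
      intro φ
      simp_rw [← sum_filter_add_sum_filter_not S (fun w => Γ.Adj x w) _, sum_add_distrib]
      rfl
    let f' : V → ℕ := fun v => if v ∈ A then f v else l
    have fA : ∀ v ∈ A, f' v = f v := fun v hv => if_pos hv
    have fB : ∀ v ∈ B, f' v = l := fun v hv => if_neg (hAB v hv)
    have fne : ∀ v ∈ A, ∀ w ∈ B, f' v ≠ f' w := fun v hv w hw => by
      rw [fA v hv, fB w hw]
      exact (hf v hv).ne
    refine ⟨f', fun v hv => ?_, ?_⟩
    · by_cases hvA : v ∈ A
      · rw [fA v hvA]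
        exact (hf v hvA).trans (Nat.lt_succ_self l)
      · simp [f', hvA]
    · rw [split, split (fun x y => if Γ.Adj x y ∧ f' x = f' y then 1 else 0),
        split (fun x y => if f' x ≠ f' y then 1 else 0)]
      have i1 : (∑ x ∈ A, ∑ y ∈ A, if Γ.Adj x y ∧ f' x = f' y then 1 else 0) =
          ∑ x ∈ A, ∑ y ∈ A, if Γ.Adj x y ∧ f x = f y then 1 else 0 :=
        sum_congr rfl fun v hv => sum_congr rfl fun w hw => by rw [fA v hv, fA w hw]
      have i2 : (∑ x ∈ A, ∑ y ∈ B, if Γ.Adj x y ∧ f' x = f' y then 1 else 0) = 0 :=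
        sum_eq_zero fun v hv => sum_eq_zero fun w hw => if_neg fun hc => fne v hv w hw hc.2
      have i3 : (∑ x ∈ B, ∑ y ∈ A, if Γ.Adj x y ∧ f' x = f' y then 1 else 0) = 0 :=
        sum_eq_zero fun v hv => sum_eq_zero fun w hw => if_neg fun hc => fne w hw v hv hc.2.symm
      have i4 : (∑ x ∈ B, ∑ y ∈ B, if Γ.Adj x y ∧ f' x = f' y then 1 else 0) =
          ∑ x ∈ B, ∑ y ∈ B, if Γ.Adj x y then 1 else 0 :=
        sum_congr rfl fun v hv => sum_congr rfl fun w hw => by simp [fB v hv, fB w hw]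
      have c1 : (∑ x ∈ A, ∑ y ∈ A, if f' x ≠ f' y then 1 else 0) =
          ∑ x ∈ A, ∑ y ∈ A, if f x ≠ f y then 1 else 0 :=
        sum_congr rfl fun v hv => sum_congr rfl fun w hw => by rw [fA v hv, fA w hw]
      have c2 : (∑ x ∈ A, ∑ y ∈ B, if f' x ≠ f' y then 1 else 0) = A.card * B.card := by
        rw [card_eq_sum_ones A, sum_mul, one_mul, card_eq_sum_ones B]
        exact sum_congr rfl fun v hv => sum_congr rfl fun w hw => if_pos (fne v hv w hw)
      have c3 : (∑ x ∈ B, ∑ y ∈ A, if f' x ≠ f' y then 1 else 0) = A.card * B.card := by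
        rw [sum_comm, ← c2]
        simp_rw [ne_comm]
      have d1 : (∑ x ∈ A, ∑ y ∈ B, if Γ.Adj x y then 1 else 0) =
          ∑ x ∈ B, ∑ y ∈ A, if Γ.Adj x y then 1 else 0 := by
        rw [sum_comm]
        simp_rw [adj_comm]
      have d2 : (∑ x ∈ B, ∑ y ∈ A, if Γ.Adj x y then 1 else 0) +
          (∑ x ∈ B, ∑ y ∈ B, if Γ.Adj x y then 1 else 0) ≤ A.card * B.card := by
        rw [← sum_add_distrib, mul_comm, ← smul_eq_mul]
        refine sum_le_card_nsmul _ _ _ fun v hv => ?_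
        rw [sum_filter_add_sum_filter_not S (fun w => Γ.Adj x w), ← card_filter]
        exact hmax v (mem_filter.1 hv).1
      omega

end SimpleGraph

end CliqueCounting

section MaximumCut

open Finset

theorem sum_sum_update_le {V : Type*} [Fintype V] [DecidableEq V] (φ ψ : V → V → ℕ) (x : V)
    (hφ : ∀ u v, φ u v = φ v u) (hψ : ∀ u v, ψ u v = ψ v u) (hxφ : φ x x = 0) (hxψ : ψ x x = 0)
    (heq : ∀ u v, u ≠ x → v ≠ x → φ u v = ψ u v)
    (hle : ∑ u, ∑ v, φ u v ≤ ∑ u, ∑ v, ψ u v) : ∑ v, φ x v ≤ ∑ v, ψ x v := by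
  have key : ∀ χ : V → V → ℕ, (∀ u v, χ u v = χ v u) → χ x x = 0 →
      ∑ u, ∑ v, χ u v = 2 * ∑ v, χ x v + ∑ u ∈ univ.erase x, ∑ v ∈ univ.erase x, χ u v := by
    intro χ hχ h0
    rw [← add_sum_erase univ _ (mem_univ x)]
    have h1 : ∀ u, ∑ v, χ u v = χ x u + ∑ v ∈ univ.erase x, χ u v := fun u => by
      rw [← add_sum_erase univ _ (mem_univ x), hχ u x]
    have h2 : ∑ v, χ x v = ∑ v ∈ univ.erase x, χ x v := by rw [h1, h0, zero_add]
    rw [sum_congr rfl fun u _ => h1 u, sum_add_distrib, ← h2]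
    ring
  rw [key φ hφ hxφ, key ψ hψ hxψ] at hle
  have : ∑ u ∈ univ.erase x, ∑ v ∈ univ.erase x, φ u v =
      ∑ u ∈ univ.erase x, ∑ v ∈ univ.erase x, ψ u v :=
    sum_congr rfl fun u hu => sum_congr rfl fun v hv =>
      heq u v (mem_erase.1 hu).1 (mem_erase.1 hv).1
  omega

theorem sum_sum_eq_indicator {V ι : Type*} [Fintype V] [Fintype ι] [DecidableEq ι] (f : V → ι) :
    (∑ x, ∑ y, if f x = f y then 1 else 0) = ∑ i, (univ.filter fun v => f v = i).card ^ 2 := by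
  have h1 : ∀ x, (∑ y, if f x = f y then 1 else 0) = (univ.filter fun v => f v = f x).card := by
    intro x
    rw [← card_filter]
    simp_rw [eq_comm]
  rw [sum_congr rfl fun x _ => h1 x, ← sum_fiberwise univ f]
  refine sum_congr rfl fun i _ => ?_
  rw [sum_congr rfl (g := fun _ => (univ.filter fun v => f v = i).card)
    fun x hx => by rw [(mem_filter.1 hx).2], sum_const, smul_eq_mul, sq]

namespace SimpleGraph

open scoped Classical in
theorem exists_max_cut {V : Type*} [Fintype V] [DecidableEq V] {Γ : SimpleGraph V} {l : ℕ}
    (hl : 0 < l) (hΓ : Γ.CliqueFree (l + 1)) {δ : ℝ}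
    (hD : (1 - 1 / l - δ) * (Fintype.card V : ℝ) ^ 2 ≤
      (univ.filter fun p : V × V => Γ.Adj p.1 p.2).card) :
    ∃ f : V → Fin l,
      ((univ.filter fun p : V × V => f p.1 ≠ f p.2 ∧ ¬ Γ.Adj p.1 p.2).card : ℝ) ≤
        2 * δ * (Fintype.card V : ℝ) ^ 2 ∧
      (∀ i, (((univ.filter fun v => f v = i).card : ℝ) - Fintype.card V / l) ^ 2 ≤
        2 * δ * (Fintype.card V : ℝ) ^ 2) ∧
      ∀ x j, (univ.filter fun y => Γ.Adj x y ∧ f y = f x).card ≤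
        (univ.filter fun y => Γ.Adj x y ∧ f y = j).card := by
  have : Nonempty (Fin l) := ⟨⟨0, hl⟩⟩
  set n : ℝ := (Fintype.card V : ℝ)
  let I : (V → Fin l) → ℕ := fun f => ∑ x, ∑ y, if Γ.Adj x y ∧ f x = f y then 1 else 0
  let C : (V → Fin l) → ℕ := fun f => ∑ x, ∑ y, if f x ≠ f y then 1 else 0
  let N : (V → Fin l) → ℕ := fun f => ∑ x, ∑ y, if f x ≠ f y ∧ ¬ Γ.Adj x y then 1 else 0
  set D : ℕ := ∑ x, ∑ y, if Γ.Adj x y then 1 else 0 with hDdef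
  have hD' : (univ.filter fun p : V × V => Γ.Adj p.1 p.2).card = D := by
    rw [card_filter, ← univ_product_univ, sum_product]
  rw [hD'] at hD
  obtain ⟨f, hf⟩ := Finite.exists_min I
  obtain ⟨g, hg, hgle⟩ := Γ.exists_greedy_partition l univ fun Q _ => hΓ Q
  have hsq : ∀ f : V → Fin l, (C f : ℝ) =
      n ^ 2 - ∑ i, ((univ.filter fun v => f v = i).card : ℝ) ^ 2 := by
    intro f
    have h1 : C f + (∑ x, ∑ y, if f x = f y then 1 else 0) = Fintype.card V ^ 2 := by
      have : ∀ x y : V, (if f x ≠ f y then 1 else 0) + (if f x = f y then 1 else 0) = 1 := by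
        intro x y
        split_ifs <;> simp_all
      simp only [C, ← sum_add_distrib, this]
      simp [sq]
    rw [sum_sum_eq_indicator] at h1
    rw [← Nat.cast_inj (R := ℝ)] at h1
    push_cast at h1
    exact eq_sub_of_add_eq h1
  have hdev : ∀ f : V → Fin l,
      ∑ i, (((univ.filter fun v => f v = i).card : ℝ) - n / l) ^ 2 = (1 - 1 / l) * n ^ 2 - C f := by
    intro f
    have h1 : ∑ i, ((univ.filter fun v => f v = i).card : ℝ) = n := by
      rw [← Nat.cast_sum, ← card_eq_sum_card_fiberwise (fun _ _ => mem_univ _)]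
      rfl
    have hl' : (l : ℝ) ≠ 0 := by exact_mod_cast hl.ne'
    simp_rw [sub_sq, sum_add_distrib, sum_sub_distrib]
    rw [← sum_mul, ← mul_sum, h1, hsq, sum_const, card_univ, Fintype.card_fin, nsmul_eq_mul]
    field_simp
    ring
  have hCle : ∀ f : V → Fin l, (C f : ℝ) ≤ (1 - 1 / l) * n ^ 2 := by
    intro f
    have := hdev f
    have h2 : 0 ≤ ∑ i, (((univ.filter fun v => f v = i).card : ℝ) - n / l) ^ 2 :=
      sum_nonneg fun i _ => sq_nonneg _
    linarith
  have hIf : (D : ℝ) + I f ≤ (1 - 1 / l) * n ^ 2 := by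
    let g' : V → Fin l := fun v => ⟨g v, hg v (mem_univ v)⟩
    have h1 : D + I g' ≤ C g' := by
      simpa only [I, C, g', ne_eq, Fin.mk.injEq] using hgle
    have h2 : D + I f ≤ C g' := (Nat.add_le_add_left (hf g') _).trans h1
    have h3 : (D : ℝ) + I f ≤ C g' := by exact_mod_cast h2
    exact h3.trans (hCle g')
  have hsplit : D + N f = C f + I f := by
    simp only [hDdef, N, C, I, ← sum_add_distrib]
    refine sum_congr rfl fun x _ => sum_congr rfl fun y _ => ?_
    by_cases h1 : Γ.Adj x y <;> by_cases h2 : f x = f y <;> simp [h1, h2]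
  have hsplit' : (D : ℝ) + N f = C f + I f := by exact_mod_cast hsplit
  have hN0 : (0 : ℝ) ≤ N f := Nat.cast_nonneg _
  refine ⟨f, ?_, fun i => ?_, fun x j => ?_⟩
  · have : (univ.filter fun p : V × V => f p.1 ≠ f p.2 ∧ ¬ Γ.Adj p.1 p.2).card = N f := by
      rw [card_filter, ← univ_product_univ, sum_product]
    rw [this]
    have := hCle f
    linarith
  · refine (single_le_sum (f := fun i => (((univ.filter fun v => f v = i).card : ℝ) - n / l) ^ 2)
      (fun i _ => sq_nonneg _) (mem_univ i)).trans ?_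
    rw [hdev f]
    linarith
  · rcases eq_or_ne j (f x) with rfl | hj
    · exact le_rfl
    have h1 := sum_sum_update_le (fun u v => if Γ.Adj u v ∧ f u = f v then 1 else 0)
      (fun u v => if Γ.Adj u v ∧ Function.update f x j u = Function.update f x j v then 1 else 0) x
      (fun u v => by simp only [Γ.adj_comm u v, eq_comm])
      (fun u v => by simp only [Γ.adj_comm u v, eq_comm]) (by simp) (by simp)
      (fun u v hu hv => by simp [hu, hv]) (hf (Function.update f x j))
    rw [← card_filter, ← card_filter] at h1
    convert h1 using 2
    · ext y
      simp [eq_comm]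
    · ext y
      simp only [mem_filter, mem_univ, true_and, Function.update_self]
      refine and_congr_right fun hxy => ?_
      rw [Function.update_of_ne hxy.ne', eq_comm]

end SimpleGraph

end MaximumCut

section Transversals

open Finset

open scoped Classical in
/-- Large sets with few non-adjacent pairs between them contain a clique of representatives. -/
theorem SimpleGraph.exists_adj_tuple {V ι : Type*} [Nonempty V] (Γ : SimpleGraph V) {M : ℝ} (hM : 0 ≤ M)
    (I : Finset ι) (W : ι → Finset V) {c : ℝ} (hc : 0 < c)
    (hW : ∀ i ∈ I, c ≤ (W i).card)
    (hP : ∀ i ∈ I, ∀ j ∈ I, i ≠ j →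
      (((W i ×ˢ W j).filter fun p => ¬ Γ.Adj p.1 p.2).card : ℝ) ≤ M)
    (hlt : 2 * I.card * M * 4 ^ I.card < c ^ 2) :
    ∃ w : ι → V, (∀ i ∈ I, w i ∈ W i) ∧ ∀ i ∈ I, ∀ j ∈ I, i ≠ j → Γ.Adj (w i) (w j) := by
  induction I using Finset.induction_on generalizing W c with
  | empty => exact ⟨fun _ => Classical.arbitrary V, by simp⟩
  | insert i I hi ih =>
    rw [card_insert_of_notMem hi] at hlt
    let X : ι → Finset V := fun j =>
      (W i).filter fun u => c < 2 * ((W j).filter fun v => ¬ Γ.Adj u v).card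
    have hX : ∀ j ∈ I, c * (X j).card ≤ 2 * M := by
      intro j hj
      have hij : i ≠ j := fun h => hi (h ▸ hj)
      have h1 := hP i (mem_insert_self i I) j (mem_insert_of_mem hj) hij
      have h2 : (((W i ×ˢ W j).filter fun p => ¬ Γ.Adj p.1 p.2).card : ℝ) =
          ∑ u ∈ W i, (((W j).filter fun v => ¬ Γ.Adj u v).card : ℝ) := by
        rw [card_filter, sum_product]
        simp_rw [← card_filter]
        push_cast
        rfl
      have h3 : ∑ u ∈ X j, (((W j).filter fun v => ¬ Γ.Adj u v).card : ℝ) ≤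
          ∑ u ∈ W i, (((W j).filter fun v => ¬ Γ.Adj u v).card : ℝ) :=
        sum_le_sum_of_subset_of_nonneg (filter_subset _ _) fun _ _ _ => Nat.cast_nonneg _
      have h4 : (X j).card • (c / 2) ≤
          ∑ u ∈ X j, (((W j).filter fun v => ¬ Γ.Adj u v).card : ℝ) := by
        refine card_nsmul_le_sum _ _ _ fun u hu => ?_
        have := (mem_filter.1 hu).2
        linarith
      rw [nsmul_eq_mul] at h4
      linarith
    have hex : ∃ u ∈ W i, ∀ j ∈ I, u ∉ X j := by
      by_contra! hcon
      have h1 : W i ⊆ I.biUnion X := fun u hu => by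
        obtain ⟨j, hj, huj⟩ := hcon u hu
        exact mem_biUnion.2 ⟨j, hj, huj⟩
      have h2 : ((W i).card : ℝ) ≤ ∑ j ∈ I, ((X j).card : ℝ) := by
        exact_mod_cast (card_le_card h1).trans card_biUnion_le
      have h3 : c * ∑ j ∈ I, ((X j).card : ℝ) ≤ I.card * (2 * M) := by
        rw [mul_sum, ← nsmul_eq_mul]
        exact sum_le_card_nsmul _ _ _ hX
      have h4 := mul_le_mul_of_nonneg_left ((hW i (mem_insert_self i I)).trans h2) hc.le
      have h5 : (1 : ℝ) ≤ 4 ^ (I.card + 1) := one_le_pow₀ (by norm_num)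
      have h6 : 2 * ((I.card + 1 : ℕ) : ℝ) * M * 1 ≤
          2 * ((I.card + 1 : ℕ) : ℝ) * M * 4 ^ (I.card + 1) :=
        mul_le_mul_of_nonneg_left h5 (by positivity)
      push_cast at h6 hlt
      nlinarith
    obtain ⟨u, hu, huX⟩ := hex
    obtain ⟨w, hw, hadj⟩ := ih (fun j => (W j).filter fun v => Γ.Adj u v) (c := c / 2)
      (by positivity) (by
        intro j hj
        have h1 : (c : ℝ) ≤ (W j).card := hW j (mem_insert_of_mem hj)
        have h2 := huX j hj
        simp only [X, mem_filter, hu, true_and, not_lt] at h2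
        have h3 : (((W j).filter fun v => Γ.Adj u v).card : ℝ) +
            ((W j).filter fun v => ¬ Γ.Adj u v).card = (W j).card := by
          exact_mod_cast card_filter_add_card_filter_not (s := W j) (fun v => Γ.Adj u v)
        linarith)
      (by
        intro j hj j' hj' hne
        refine le_trans ?_ (hP j (mem_insert_of_mem hj) j' (mem_insert_of_mem hj') hne)
        exact_mod_cast card_le_card (filter_subset_filter _
          (product_subset_product (filter_subset _ _) (filter_subset _ _))))
      (by
        have h1 : (0 : ℝ) ≤ M * 4 ^ I.card := by positivity
        rw [pow_succ] at hlt
        push_cast at hlt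
        nlinarith)
    refine ⟨Function.update w i u, fun j hj => ?_, fun j hj j' hj' hne => ?_⟩
    · rcases eq_or_ne j i with rfl | hji
      · simpa using hu
      · rw [Function.update_of_ne hji]
        exact (mem_filter.1 (hw j ((mem_insert.1 hj).resolve_left hji))).1
    · rcases eq_or_ne j i with rfl | hji
      · rw [Function.update_self, Function.update_of_ne hne.symm]
        exact (mem_filter.1 (hw j' ((mem_insert.1 hj').resolve_left hne.symm))).2
      · have h1 := (mem_insert.1 hj).resolve_left hji
        rw [Function.update_of_ne hji]
        rcases eq_or_ne j' i with rfl | hji'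
        · rw [Function.update_self]
          exact (mem_filter.1 (hw j h1)).2.symm
        · rw [Function.update_of_ne hji']
          exact hadj j h1 j' ((mem_insert.1 hj').resolve_left hji') hne

/-- The sets meeting exactly the classes in `J`, each in one vertex. -/
def transversals {V ι : Type*} [Fintype V] [DecidableEq V] [DecidableEq ι] (f : V → ι)
    (J : Finset ι) : Finset (Finset V) :=
  univ.filter fun e => (∀ x ∈ e, ∀ y ∈ e, f x = f y → x = y) ∧ e.image f = J

variable {V ι : Type*} [Fintype V] [DecidableEq V] [DecidableEq ι] {f : V → ι}

theorem mem_transversals {J : Finset ι} {e : Finset V} : e ∈ transversals f J ↔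
    (∀ x ∈ e, ∀ y ∈ e, f x = f y → x = y) ∧ e.image f = J := by
  simp [transversals]

theorem notMem_of_mem_transversals {J : Finset ι} {e : Finset V} (he : e ∈ transversals f J)
    {v : V} (hv : f v ∉ J) : v ∉ e := fun h =>
  hv ((mem_transversals.1 he).2 ▸ mem_image_of_mem f h)

theorem card_of_mem_transversals {J : Finset ι} {e : Finset V} (he : e ∈ transversals f J) :
    e.card = J.card := by
  obtain ⟨h1, h2⟩ := mem_transversals.1 he
  rw [← h2, card_image_of_injOn]
  exact fun x hx y hy => h1 x hx y hy

theorem insert_mem_transversals {J : Finset ι} {e : Finset V} (he : e ∈ transversals f J)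
    {v : V} (hv : f v ∉ J) : insert v e ∈ transversals f (insert (f v) J) := by
  obtain ⟨h1, h2⟩ := mem_transversals.1 he
  have h3 : ∀ y ∈ e, f v ≠ f y := fun y hy h => hv (h ▸ h2 ▸ mem_image_of_mem f hy)
  refine mem_transversals.2 ⟨fun x hx y hy hxy => ?_, by rw [image_insert, h2]⟩
  rcases mem_insert.1 hx with hx' | hx' <;> rcases mem_insert.1 hy with hy' | hy'
  · exact hx'.trans hy'.symm
  · exact absurd (hx' ▸ hxy) (h3 y hy')
  · exact absurd (hy' ▸ hxy.symm) (h3 x hx')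
  · exact h1 x hx' y hy' hxy

theorem card_transversals (f : V → ι) (J : Finset ι) :
    (transversals f J).card = ∏ j ∈ J, (univ.filter fun v => f v = j).card := by
  induction J using Finset.induction_on with
  | empty =>
    have : transversals f ∅ = {∅} := by
      ext e
      rw [mem_transversals, image_eq_empty, mem_singleton]
      exact ⟨fun h => h.2, by rintro rfl; simp⟩
    rw [this]
    simp
  | insert j J hj ih =>
    rw [prod_insert hj, ← ih, ← card_product]
    symm
    refine card_nbij (fun p => insert p.1 p.2) ?_ ?_ ?_
    · rintro ⟨v, e⟩ h
      obtain ⟨h1, h2⟩ := mem_product.1 h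
      simp only [mem_filter, mem_univ, true_and] at h1
      subst h1
      exact insert_mem_transversals h2 hj
    · rintro ⟨v, e⟩ h ⟨v', e'⟩ h' heq
      obtain ⟨h1, h2⟩ := mem_product.1 h
      obtain ⟨h1', h2'⟩ := mem_product.1 h'
      simp only [mem_filter, mem_univ, true_and] at h1 h1' heq
      have hve' : v ∉ e' := notMem_of_mem_transversals h2' (h1 ▸ hj)
      have hve : v ∉ e := notMem_of_mem_transversals h2 (h1 ▸ hj)
      have hvv : v = v' := by
        have : v ∈ insert v' e' := heq ▸ mem_insert_self v e
        exact (mem_insert.1 this).resolve_right hve'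
      subst hvv
      rw [Prod.mk.injEq]
      refine ⟨rfl, ?_⟩
      rw [← erase_insert hve, heq, erase_insert hve']
    · intro e he
      obtain ⟨h1, h2⟩ := mem_transversals.1 he
      obtain ⟨v, hv, rfl⟩ := mem_image.1 (h2 ▸ mem_insert_self j J)
      refine ⟨(v, e.erase v), mem_product.2 ⟨by simp, mem_transversals.2 ⟨?_, ?_⟩⟩,
        insert_erase hv⟩
      · exact fun x hx y hy => h1 x (mem_of_mem_erase hx) y (mem_of_mem_erase hy)
      · ext i
        simp only [mem_image, mem_erase]
        constructor
        · rintro ⟨x, ⟨hx, hxe⟩, rfl⟩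
          have : f x ∈ insert (f v) J := h2 ▸ mem_image_of_mem f hxe
          exact (mem_insert.1 this).resolve_left fun h => hx (h1 x hxe v hv h)
        · intro hi
          obtain ⟨x, hx, rfl⟩ := mem_image.1 (h2 ▸ mem_insert_of_mem hi)
          exact ⟨x, ⟨fun h => hj (h ▸ hi), hx⟩, rfl⟩

namespace KGraph

/-- The `k`-graph of all `k`-sets that meet every class of `f` in at most one vertex. -/
def rainbow (f : V → ι) (k : ℕ) : KGraph V k where
  edges := (powersetCard k univ).filter fun e => ∀ x ∈ e, ∀ y ∈ e, f x = f y → x = y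
  sized := fun _ he => (mem_powersetCard.1 (mem_filter.1 (mem_coe.1 he)).1).2

theorem mem_rainbow {k : ℕ} {e : Finset V} : e ∈ (rainbow f k).edges ↔
    e.card = k ∧ ∀ x ∈ e, ∀ y ∈ e, f x = f y → x = y := by
  simp [rainbow, mem_powersetCard]

theorem size_rainbow [Fintype ι] (f : V → ι) (k : ℕ) : (rainbow f k).size =
    ∑ J ∈ powersetCard k univ, ∏ j ∈ J, (univ.filter fun v => f v = j).card := by
  rw [size, card_eq_sum_card_fiberwise (f := fun e => e.image f) (t := powersetCard k univ)]
  · refine sum_congr rfl fun J hJ => ?_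
    rw [← card_transversals]
    congr 1
    ext e
    rw [mem_filter, mem_rainbow, mem_transversals]
    constructor
    · exact fun h => ⟨h.1.2, h.2⟩
    · intro h
      refine ⟨⟨?_, h.1⟩, h.2⟩
      rw [card_of_mem_transversals (mem_transversals.2 h), (mem_powersetCard.1 hJ).2]
  · intro e he
    have h := mem_rainbow.1 (mem_coe.1 he)
    refine mem_coe.2 (mem_powersetCard.2 ⟨subset_univ _, ?_⟩)
    rw [card_image_of_injOn fun x hx y hy => h.2 x hx y hy, h.1]

theorem le_card_rainbow_pair [Fintype ι] {k c : ℕ} (hk : 2 ≤ k) (hkι : k ≤ Fintype.card ι)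
    (hc : ∀ i, c ≤ (univ.filter fun v => f v = i).card) {x y : V} (hxy : f x ≠ f y) :
    c ^ (k - 2) ≤ ((rainbow f k).edges.filter fun e => x ∈ e ∧ y ∈ e).card := by
  obtain ⟨J, hJ, hJc⟩ := exists_subset_card_eq
    (s := univ \ {f x, f y}) (n := k - 2) (by
      rw [card_sdiff_of_subset (subset_univ _), card_pair hxy, card_univ]
      omega)
  have hxJ : f x ∉ J := fun h => by simpa using hJ h
  have hyJ : f y ∉ J := fun h => by simpa using hJ h
  have hxJ' : f x ∉ insert (f y) J := by simp [hxy, hxJ]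
  calc c ^ (k - 2) = ∏ j ∈ J, c := by rw [prod_const, hJc]
    _ ≤ ∏ j ∈ J, (univ.filter fun v => f v = j).card := prod_le_prod' fun i _ => hc i
    _ = (transversals f J).card := (card_transversals f J).symm
    _ ≤ _ := by
      refine card_le_card_of_injOn (fun e => insert x (insert y e)) ?_ ?_
      · intro e he
        have h1 := insert_mem_transversals (insert_mem_transversals he hyJ) hxJ'
        refine mem_coe.2 (mem_filter.2 ⟨mem_rainbow.2 ⟨?_, (mem_transversals.1 h1).1⟩,
          by simp, by simp⟩)
        rw [card_of_mem_transversals h1, card_insert_of_notMem hxJ', card_insert_of_notMem hyJ]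
        omega
      · intro e he e' he' heq
        simp only at heq
        have hx : ∀ e ∈ transversals f J, x ∉ insert y e := fun e he =>
          notMem_of_mem_transversals (insert_mem_transversals he hyJ) hxJ'
        have hy : ∀ e ∈ transversals f J, y ∉ e := fun e he =>
          notMem_of_mem_transversals he hyJ
        rw [← erase_insert (hy e he), ← erase_insert (hx e he), heq, erase_insert (hx e' he'),
          erase_insert (hy e' he')]

end KGraph

end Transversals

section TuranOptimal

open Finset

/-- The elementary symmetric polynomial of degree `r` in the values of `a` on `S`. -/
def esymmOn {ι : Type*} (a : ι → ℕ) (r : ℕ) (S : Finset ι) : ℕ :=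
  ∑ J ∈ powersetCard r S, ∏ j ∈ J, a j

theorem esymmOn_insert {ι : Type*} [DecidableEq ι] (a : ι → ℕ) (r : ℕ) {S : Finset ι} {i : ι}
    (hi : i ∉ S) : esymmOn a (r + 1) (insert i S) = esymmOn a (r + 1) S + a i * esymmOn a r S := by
  have hmem : ∀ J ∈ powersetCard r S, i ∉ J := fun J hJ h => hi ((mem_powersetCard.1 hJ).1 h)
  rw [esymmOn, powersetCard_succ_insert hi, sum_union, sum_image, esymmOn, esymmOn, mul_sum]
  · congr 1
    exact sum_congr rfl fun J hJ => prod_insert (hmem J hJ)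
  · intro J hJ J' hJ' h
    rw [← erase_insert (hmem J hJ), h, erase_insert (hmem J' hJ')]
  · rw [disjoint_left]
    intro J hJ hJ'
    obtain ⟨J', -, rfl⟩ := mem_image.1 hJ'
    exact hi ((mem_powersetCard.1 hJ).1 (mem_insert_self i J'))

theorem esymmOn_congr {ι : Type*} {a b : ι → ℕ} (r : ℕ) {S : Finset ι}
    (h : ∀ j ∈ S, a j = b j) : esymmOn a r S = esymmOn b r S :=
  sum_congr rfl fun _ hJ => prod_congr rfl fun j hj => h j ((mem_powersetCard.1 hJ).1 hj)

theorem esymmOn_lt_of_balance {ι : Type*} [Fintype ι] [DecidableEq ι] {a b : ι → ℕ} {r : ℕ}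
    {i j : ι} (hij : i ≠ j) (hab : ∀ m, m ≠ i → m ≠ j → a m = b m) (hi : b i = a i + 1)
    (hj : b j + 1 = a j) (hlt : a i + 1 < a j) (hpos : 0 < esymmOn a (r + 2) univ) :
    esymmOn a (r + 2) univ < esymmOn b (r + 2) univ := by
  set S : Finset ι := univ \ {i, j} with hS
  have hiS : i ∉ insert j S := by simp [hS, hij]
  have hjS : j ∉ S := by simp [hS]
  have huniv : univ = insert i (insert j S) := by
    ext m
    simp only [hS, mem_univ, mem_insert, mem_sdiff, mem_singleton, true_and, true_iff]
    tauto
  have hSab : ∀ m ∈ S, b m = a m := fun m hm => by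
    simp only [hS, mem_sdiff, mem_univ, mem_insert, mem_singleton, true_and, not_or] at hm
    exact (hab m hm.1 hm.2).symm
  have hr : 0 < esymmOn a r S := by
    obtain ⟨J, hJ, hJ0⟩ := exists_ne_zero_of_sum_ne_zero hpos.ne'
    obtain ⟨J', hJ', hJc⟩ := exists_subset_card_eq (s := J \ {i, j}) (n := r) (by
      have h1 := le_card_sdiff {i, j} J
      rw [(mem_powersetCard.1 hJ).2, card_pair hij] at h1
      omega)
    refine (Nat.pos_of_ne_zero ?_).trans_le (single_le_sum (f := fun J => ∏ m ∈ J, a m)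
      (fun _ _ => Nat.zero_le _) (mem_powersetCard.2
        ⟨hJ'.trans (sdiff_subset_sdiff (subset_univ J) subset_rfl), hJc⟩))
    rw [prod_ne_zero_iff] at hJ0 ⊢
    exact fun m hm => hJ0 m (mem_sdiff.1 (hJ' hm)).1
  rw [huniv, esymmOn_insert _ _ hiS, esymmOn_insert _ _ hjS, esymmOn_insert _ _ hjS,
    esymmOn_insert _ _ hiS, esymmOn_insert _ _ hjS, esymmOn_insert _ _ hjS,
    esymmOn_congr _ hSab, esymmOn_congr (r + 1) hSab, esymmOn_congr r hSab, hi, ← hj]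
  have : a i < b j := by omega
  nlinarith

namespace KGraph

theorem Isomorphic.size_eq {V W : Type*} [DecidableEq W] {k : ℕ} {G : KGraph V k} {F : KGraph W k}
    (h : G.Isomorphic F) : G.size = F.size := by
  obtain ⟨σ, hσ⟩ := h
  refine card_bij (fun e _ => e.map σ.toEmbedding) (fun e he => (hσ e).1 he)
    (fun e _ e' _ h => map_injective _ h) fun e he => ?_
  refine ⟨e.map σ.symm.toEmbedding, (hσ _).2 ?_, ?_⟩ <;>
    simp [map_map, he]

theorem Isomorphic.contains {V W U : Type*} {k : ℕ} {G : KGraph V k} {F : KGraph W k}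
    {H : KGraph U k} (h : G.Isomorphic F) (hG : G.Contains H) : F.Contains H := by
  obtain ⟨σ, hσ⟩ := h
  obtain ⟨f, hf⟩ := hG
  exact ⟨f.trans σ.toEmbedding, fun e he => by rw [← map_map]; exact (hσ _).1 (hf e he)⟩

variable {V ι : Type*} [Fintype V] [DecidableEq V] [DecidableEq ι] [Fintype ι]

theorem balanced_of_size_rainbow_maximal {f : V → ι} {k : ℕ} (hk : 2 ≤ k)
    (hpos : 0 < (rainbow f k).size) (hmax : ∀ g : V → ι, (rainbow g k).size ≤ (rainbow f k).size)
    (i j : ι) : (univ.filter fun v => f v = j).card ≤ (univ.filter fun v => f v = i).card + 1 := by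
  by_contra! hlt
  obtain ⟨r, rfl⟩ := Nat.exists_eq_add_of_le' hk
  have hij : i ≠ j := by
    rintro rfl
    omega
  obtain ⟨v, hv⟩ := card_pos.1 ((Nat.zero_le _).trans_lt hlt)
  simp only [mem_filter, mem_univ, true_and] at hv
  have h1 := hmax (Function.update f v i)
  rw [size_rainbow] at hpos
  rw [size_rainbow, size_rainbow] at h1
  refine h1.not_gt (esymmOn_lt_of_balance hij ?_ ?_ ?_ hlt hpos)
  · intro m hmi hmj
    congr 1
    ext w
    rcases eq_or_ne w v with rfl | hw
    · simp [hv, hmi.symm, hmj.symm]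
    · simp [hw]
  · have : (univ.filter fun w => Function.update f v i w = i) =
        insert v (univ.filter fun w => f w = i) := by
      ext w
      rcases eq_or_ne w v with rfl | hw
      · simp
      · simp [hw]
    rw [this, card_insert_of_notMem]
    simp [hv, hij.symm]
  · have : (univ.filter fun w => f w = j) =
        insert v (univ.filter fun w => Function.update f v i w = j) := by
      ext w
      rcases eq_or_ne w v with rfl | hw
      · simp [hv]
      · simp [hw]
    rw [this, card_insert_of_notMem]
    simp [hij]

theorem isomorphic_turan_of_balanced {n l : ℕ} (k : ℕ) (hn : l ≤ n) {f : Fin n → Fin l}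
    (hf : ∀ i j, (univ.filter fun v => f v = j).card ≤ (univ.filter fun v => f v = i).card + 1) :
    (rainbow f k).Isomorphic (turan k n l) := by
  have hne : ∀ i, (univ.filter fun v => f v = i).Nonempty := by
    intro i
    by_contra h
    rw [not_nonempty_iff_eq_empty] at h
    have h1 : n = ∑ j, (univ.filter fun v => f v = j).card := by
      rw [← card_eq_sum_card_fiberwise (fun _ _ => mem_univ _), card_univ, Fintype.card_fin]
    have h2 : ∑ j, (univ.filter fun v => f v = j).card < ∑ j : Fin l, 1 := by
      refine sum_lt_sum (fun j _ => ?_) ⟨i, mem_univ i, by rw [h]; simp⟩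
      simpa [h] using hf i j
    simp at h2
    omega
  classical
  let P : Finpartition (univ : Finset (Fin n)) := Finpartition.ofSetoid (Setoid.ker f)
  have hpart : ∀ a b, b ∈ P.part a ↔ f a = f b := fun a b =>
    Finpartition.mem_part_ofSetoid_iff_rel
  have hparts : P.parts = univ.image fun i => univ.filter fun v => f v = i := by
    ext s
    simp only [mem_image, mem_univ, true_and]
    constructor
    · intro hs
      obtain ⟨a, ha⟩ := P.nonempty_of_mem_parts hs
      refine ⟨f a, ?_⟩
      rw [← P.part_eq_of_mem hs ha]
      ext b
      simp [hpart, eq_comm]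
    · rintro ⟨i, rfl⟩
      obtain ⟨a, ha⟩ := hne i
      rw [mem_filter] at ha
      have : (univ.filter fun v => f v = i) = P.part a := by
        ext b
        simp [hpart, ha.2, eq_comm]
      rw [this]
      exact P.part_mem.2 (mem_univ a)
  have hcard : P.parts.card = l := by
    rw [hparts, card_image_of_injective, card_univ, Fintype.card_fin]
    intro i j hij
    obtain ⟨a, ha⟩ := hne i
    have ha' : a ∈ univ.filter fun v => f v = j := by
      simp only at hij
      rwa [← hij]
    exact (mem_filter.1 ha).2.symm.trans (mem_filter.1 ha').2
  have heq : P.IsEquipartition := by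
    rw [Finpartition.IsEquipartition, Set.EquitableOn]
    intro s t hs ht
    rw [hparts] at hs ht
    obtain ⟨i, -, rfl⟩ := mem_image.1 (mem_coe.1 hs)
    obtain ⟨j, -, rfl⟩ := mem_image.1 (mem_coe.1 ht)
    exact hf j i
  obtain ⟨σ, hσ⟩ := heq.exists_partPreservingEquiv
  have hc : (univ : Finset (Fin n)).card = n := by simp
  let τ : Fin n ≃ Fin n :=
    ((Equiv.subtypeUnivEquiv fun a => mem_univ a).symm.trans σ).trans (finCongr hc)
  have hτ : ∀ a b, f a = f b ↔ (τ a).val % l = (τ b).val % l := by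
    intro a b
    have := hσ ⟨a, mem_univ a⟩ ⟨b, mem_univ b⟩
    rw [hcard] at this
    rw [← hpart]
    refine Iff.trans ⟨fun h => ?_, fun h => ?_⟩ this
    · ext c
      rw [hpart, hpart, (hpart a b).1 h]
    · simp only at h
      rw [h, hpart]
  refine ⟨τ, fun e => ?_⟩
  rw [mem_rainbow, turan, mem_filter, mem_powersetCard, card_map]
  simp only [subset_univ, true_and, forall_mem_map, Equiv.coe_toEmbedding, ← hτ,
    EmbeddingLike.apply_eq_iff_eq]

theorem turan_edges_eq_rainbow {n l : ℕ} (hl : 0 < l) (k : ℕ) :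
    (turan k n l).edges =
      (rainbow (fun x : Fin n => (⟨x.val % l, Nat.mod_lt _ hl⟩ : Fin l)) k).edges := by
  simp [turan, rainbow]

theorem le_size_turan {n l : ℕ} (hl : 0 < l) (k : ℕ) :
    l.choose k * (n / l) ^ k ≤ (turan k n l).size := by
  rw [size, turan_edges_eq_rainbow hl, ← size, size_rainbow]
  have h1 : (powersetCard k (univ : Finset (Fin l))).card = l.choose k := by simp
  rw [← h1, ← smul_eq_mul]
  refine card_nsmul_le_sum _ _ _ fun J hJ => ?_
  rw [← (mem_powersetCard.1 hJ).2, ← prod_const]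
  refine prod_le_prod' fun i _ => ?_
  rw [← card_range (n / l)]
  have hb : ∀ t ∈ range (n / l), i.val + l * t < n := by
    intro t ht
    have h2 := Nat.mul_le_mul_left l (mem_range.1 ht)
    have h3 := Nat.mul_div_le n l
    have h4 := i.isLt
    rw [Nat.mul_succ] at h2
    omega
  refine card_le_card_of_surjOn (fun x => x.val / l) ?_
  intro t ht
  refine ⟨⟨i.val + l * t, hb t ht⟩, ?_, ?_⟩
  · simp [Nat.mod_eq_of_lt i.isLt]
  · simp [Nat.add_mul_div_left _ _ hl]

theorem exists_size_rainbow_le_turan {n l k : ℕ} (hk : 2 ≤ k) (hkl : k ≤ l) (hn : l ≤ n)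
    (f : Fin n → Fin l) : (rainbow f k).size ≤ (turan k n l).size ∧
      ((turan k n l).size ≤ (rainbow f k).size → (rainbow f k).Isomorphic (turan k n l)) := by
  have hl : 0 < l := by omega
  have : Nonempty (Fin l) := ⟨⟨0, hl⟩⟩
  have hpos : 0 < (turan k n l).size :=
    (Nat.mul_pos (Nat.choose_pos hkl) (pow_pos (Nat.div_pos hn hl) k)).trans_le (le_size_turan hl k)
  obtain ⟨g, hg⟩ := Finite.exists_max fun g : Fin n → Fin l => (rainbow g k).size
  have hturan : (turan k n l).size ≤ (rainbow g k).size := by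
    refine le_trans (le_of_eq ?_) (hg fun x => ⟨x.val % l, Nat.mod_lt _ hl⟩)
    rw [size, turan_edges_eq_rainbow hl, ← size]
  have hgT := isomorphic_turan_of_balanced k hn
    (balanced_of_size_rainbow_maximal hk (hpos.trans_le hturan) hg)
  refine ⟨hgT.size_eq ▸ hg f, fun hle => isomorphic_turan_of_balanced k hn
    (balanced_of_size_rainbow_maximal hk (hpos.trans_le hle) fun g' => ?_)⟩
  exact ((hg g').trans hgT.size_eq.le).trans hle

end KGraph

end TuranOptimal

section Embedding

open Finset

namespace KGraph

variable {V : Type*} [DecidableEq V] {k : ℕ} (G : KGraph V k)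

/-- The number of edges through two vertices. -/
def codegree (x y : V) : ℕ := (G.edges.filter fun e => x ∈ e ∧ y ∈ e).card

theorem codegree_comm (x y : V) : G.codegree x y = G.codegree y x := by
  simp only [codegree, and_comm]

theorem contains_expandedComplete_of_edges {G : KGraph V k} {m : ℕ} (hk : 2 ≤ k) (c : Fin m ↪ V)
    (E : Pair m → Finset V) (hE : ∀ p, E p ∈ G.edges) (hEc : ∀ p, E p ∩ univ.map c = p.1.map c)
    (hdisj : ∀ p q, p ≠ q → Disjoint (E p \ univ.map c) (E q \ univ.map c)) :
    G.Contains (expandedComplete k m hk) := by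
  have hcard : ∀ p, (E p \ univ.map c).card = k - 2 := by
    intro p
    have h1 := card_sdiff_add_card_inter (E p) (univ.map c)
    have h2 : (E p).card = k := G.sized (mem_coe.2 (hE p))
    rw [hEc, card_map, p.2, h2] at h1
    omega
  let ψ : ∀ p, Fin (k - 2) ≃ (E p \ univ.map c : Finset V) := fun p =>
    ((E p \ univ.map c).equivFinOfCardEq (hcard p)).symm
  have hψ : ∀ p t, (ψ p t : V) ∈ E p ∧ (ψ p t : V) ∉ univ.map c := fun p t =>
    mem_sdiff.1 (ψ p t).2
  let φ : ExpandedVertex k m → V := Sum.elim c fun q => ψ q.1 q.2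
  have hφ : Function.Injective φ := by
    refine Function.Injective.sumElim c.injective ?_ ?_
    · rintro ⟨p, t⟩ ⟨q, s⟩ h
      simp only at h
      by_cases hpq : p = q
      · subst hpq
        rw [(ψ p).injective (Subtype.ext h)]
      · exact absurd (h ▸ (ψ q s).2) (disjoint_left.1 (hdisj p q hpq) (ψ p t).2)
    · rintro i ⟨p, t⟩ h
      exact (hψ p t).2 (h ▸ mem_map_of_mem c (mem_univ i))
  refine ⟨⟨φ, hφ⟩, fun e he => ?_⟩
  have he' : e.card = k := (expandedComplete k m hk).sized (mem_coe.2 he)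
  simp only [expandedComplete, mem_image, mem_univ, true_and] at he
  obtain ⟨p, rfl⟩ := he
  have h1 : (expandedEdge k m p).map ⟨φ, hφ⟩ = E p := by
    refine eq_of_subset_of_card_le ?_ ?_
    · intro v hv
      obtain ⟨u, hu, rfl⟩ := mem_map.1 hv
      rcases u with i | ⟨q, t⟩
      · have hi : i ∈ p.1 := by simpa [expandedEdge] using hu
        have : c i ∈ E p ∩ univ.map c := hEc p ▸ mem_map_of_mem c hi
        exact (mem_inter.1 this).1
      · have hq : p = q := by simpa [expandedEdge] using hu
        subst hq
        exact (hψ p t).1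
    · rw [card_map, he', G.sized (mem_coe.2 (hE p))]
  rw [h1]
  exact hE p

variable [Fintype V]

theorem card_edges_superset_le (Q : Finset V) :
    (G.edges.filter fun e => Q ⊆ e).card ≤ Fintype.card V ^ (k - Q.card) := by
  have h1 : (powersetCard (k - Q.card) (univ : Finset V)).card ≤
      Fintype.card V ^ (k - Q.card) := by
    rw [card_powersetCard, card_univ]
    exact Nat.choose_le_pow _ _
  refine le_trans (card_le_card_of_injOn (fun e => e \ Q) ?_ ?_) h1
  · intro e he
    obtain ⟨h2, h3⟩ := mem_filter.1 (mem_coe.1 he)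
    refine mem_coe.2 (mem_powersetCard.2 ⟨subset_univ _, ?_⟩)
    rw [card_sdiff_of_subset h3, G.sized h2]
  · intro e he e' he' h
    simp only at h
    rw [← sdiff_union_of_subset (mem_filter.1 (mem_coe.1 he)).2, h,
      sdiff_union_of_subset (mem_filter.1 (mem_coe.1 he')).2]

theorem codegree_le {x y : V} (hxy : x ≠ y) : G.codegree x y ≤ Fintype.card V ^ (k - 2) := by
  have := G.card_edges_superset_le {x, y}
  rw [card_pair hxy] at this
  refine le_trans (le_of_eq ?_) this
  rw [codegree]
  congr 1
  ext e
  simp [insert_subset_iff]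

/-- The pairs of vertices lying in more than `N` common edges. -/
def heavyGraph (N : ℕ) : SimpleGraph V where
  Adj x y := x ≠ y ∧ N < G.codegree x y
  symm := ⟨fun x y h => ⟨h.1.symm, G.codegree_comm x y ▸ h.2⟩⟩
  loopless := ⟨fun _ h => h.1 rfl⟩

variable {G}

theorem exists_edge_avoiding {K : ℕ} {x y : V}
    (h : (G.heavyGraph (K * Fintype.card V ^ (k - 3))).Adj x y) {F : Finset V} (hF : F.card ≤ K) :
    ∃ e ∈ G.edges, x ∈ e ∧ y ∈ e ∧ ∀ z ∈ e, z ∈ F → z = x ∨ z = y := by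
  by_contra! hcon
  obtain ⟨hxy, hlt⟩ := h
  refine hlt.not_ge ?_
  have h1 : (G.edges.filter fun e => x ∈ e ∧ y ∈ e) ⊆
      (F \ {x, y}).biUnion fun z => G.edges.filter fun e => {x, y, z} ⊆ e := by
    intro e he
    obtain ⟨h2, h3, h4⟩ := mem_filter.1 he
    obtain ⟨z, hz, hzF, hzx, hzy⟩ := hcon e h2 h3 h4
    refine mem_biUnion.2 ⟨z, by simp [hzF, hzx, hzy], mem_filter.2 ⟨h2, ?_⟩⟩
    simp [insert_subset_iff, h3, h4, hz]
  calc G.codegree x y ≤ _ := card_le_card h1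
    _ ≤ (F \ {x, y}).card * Fintype.card V ^ (k - 3) := by
      refine card_biUnion_le_card_mul _ _ _ fun z hz => ?_
      have h2 := G.card_edges_superset_le {x, y, z}
      simp only [mem_sdiff, mem_insert, mem_singleton, not_or] at hz
      rwa [card_eq_three.2 ⟨x, y, z, hxy, Ne.symm hz.2.1, Ne.symm hz.2.2, rfl⟩] at h2
    _ ≤ K * Fintype.card V ^ (k - 3) :=
      Nat.mul_le_mul_right _ ((card_le_card sdiff_subset).trans hF)

/-- Greedy embedding: an edge for one pair of core vertices is given, and all the other pairs of
core vertices lie in many edges. -/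
theorem contains_expandedComplete_of_core {m : ℕ} (hk : 2 ≤ k) (c : Fin m ↪ V) (p₀ : Pair m)
    {e₀ : Finset V} (he₀ : e₀ ∈ G.edges) (hc₀ : e₀ ∩ univ.map c = p₀.1.map c)
    (hheavy : ∀ i j, i ≠ j → {i, j} ≠ p₀.1 →
      (G.heavyGraph (Fintype.card (ExpandedVertex k m) * Fintype.card V ^ (k - 3))).Adj
        (c i) (c j)) :
    G.Contains (expandedComplete k m hk) := by
  have hcard : ∀ (p : Pair m) (e : Finset V), e ∈ G.edges → e ∩ univ.map c = p.1.map c →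
      (e \ univ.map c).card = k - 2 := by
    intro p e he hec
    have h1 := card_sdiff_add_card_inter e (univ.map c)
    rw [hec, card_map, p.2, G.sized (mem_coe.2 he)] at h1
    omega
  have key : ∀ P : Finset (Pair m), ∃ E : Pair m → Finset V, ∀ p ∈ insert p₀ P,
      E p ∈ G.edges ∧ E p ∩ univ.map c = p.1.map c ∧
      ∀ q ∈ insert p₀ P, p ≠ q → Disjoint (E p \ univ.map c) (E q \ univ.map c) := by
    intro P
    induction P using Finset.induction_on with
    | empty =>
      refine ⟨fun _ => e₀, fun p hp => ?_⟩
      have : p = p₀ := by simpa using hp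
      subst this
      refine ⟨he₀, hc₀, fun q hq hpq => ?_⟩
      exact absurd (by simpa using hq) hpq.symm
    | insert r P hr ih =>
      obtain ⟨E, hE⟩ := ih
      by_cases hrP : r ∈ insert p₀ P
      · refine ⟨E, ?_⟩
        rwa [insert_comm, insert_eq_of_mem hrP]
      let F : Finset V := univ.map c ∪ (insert p₀ P).biUnion fun p => E p \ univ.map c
      have hF : F.card ≤ Fintype.card (ExpandedVertex k m) := by
        refine (card_union_le _ _).trans ?_
        rw [Fintype.card_sum, Fintype.card_prod, card_map, card_univ, Fintype.card_fin (k - 2)]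
        refine Nat.add_le_add_left ((card_biUnion_le_card_mul _ _ (k - 2) fun p hp => ?_).trans
          (Nat.mul_le_mul_right _ (card_le_univ _))) _
        exact (hcard p _ (hE p hp).1 (hE p hp).2.1).le
      obtain ⟨i, j, hij, hr2⟩ := card_eq_two.1 r.2
      have hne : ({i, j} : Finset (Fin m)) ≠ p₀.1 := fun h =>
        hrP (mem_insert.2 (Or.inl (Subtype.ext (hr2.trans h))))
      obtain ⟨e, he, hie, hje, hav⟩ := exists_edge_avoiding (hheavy i j hij hne) hF
      have hec : e ∩ univ.map c = r.1.map c := by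
        ext z
        rw [hr2, map_insert, map_singleton, mem_inter, mem_insert, mem_singleton]
        constructor
        · exact fun h => hav z h.1 (mem_union_left _ h.2)
        · rintro (rfl | rfl)
          · exact ⟨hie, mem_map_of_mem c (mem_univ _)⟩
          · exact ⟨hje, mem_map_of_mem c (mem_univ _)⟩
      have hed : ∀ q ∈ insert p₀ P, Disjoint (e \ univ.map c) (E q \ univ.map c) := by
        intro q hq
        rw [disjoint_left]
        intro z hz hzq
        have h1 := hav z (mem_sdiff.1 hz).1
          (mem_union_right _ (mem_biUnion.2 ⟨q, hq, hzq⟩))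
        refine (mem_sdiff.1 hz).2 ?_
        rcases h1 with rfl | rfl <;> exact mem_map_of_mem c (mem_univ _)
      have hupd : ∀ q ∈ insert p₀ P, Function.update E r e q = E q := fun q hq =>
        Function.update_of_ne (by rintro rfl; exact hrP hq) _ _
      refine ⟨Function.update E r e, fun p hp => ?_⟩
      rw [insert_comm] at hp ⊢
      rcases mem_insert.1 hp with rfl | hp'
      · rw [Function.update_self]
        refine ⟨he, hec, fun q hq hpq => ?_⟩
        have hq' := (mem_insert.1 hq).resolve_left hpq.symm
        rw [hupd q hq']
        exact hed q hq'
      · rw [hupd p hp']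
        refine ⟨(hE p hp').1, (hE p hp').2.1, fun q hq hpq => ?_⟩
        rcases mem_insert.1 hq with rfl | hq'
        · rw [Function.update_self]
          exact (hed p hp').symm
        · rw [hupd q hq']
          exact (hE p hp').2.2 q hq' hpq
  obtain ⟨E, hE⟩ := key univ
  have hmem : ∀ p, p ∈ insert p₀ (univ : Finset (Pair m)) := fun p => by simp
  exact contains_expandedComplete_of_edges hk c E (fun p => (hE p (hmem p)).1)
    (fun p => (hE p (hmem p)).2.1) fun p q => (hE p (hmem p)).2.2 q (hmem q)

theorem Free.cliqueFree_heavyGraph {m : ℕ} (hk : 2 ≤ k) (hm : 2 ≤ m)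
    (hG : G.Free (expandedComplete k m hk)) :
    (G.heavyGraph (Fintype.card (ExpandedVertex k m) * Fintype.card V ^ (k - 3))).CliqueFree
      m := by
  by_contra hcon
  obtain ⟨φ⟩ := SimpleGraph.not_cliqueFree_iff_top_isContained m |>.1 hcon
  let c : Fin m ↪ V := φ.toEmbedding
  have hc : ∀ i j, i ≠ j →
      (G.heavyGraph (Fintype.card (ExpandedVertex k m) * Fintype.card V ^ (k - 3))).Adj
        (c i) (c j) := fun i j hij => φ.toHom.map_adj hij
  let i : Fin m := ⟨0, by omega⟩
  let j : Fin m := ⟨1, by omega⟩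
  have hij : i ≠ j := by simp [i, j]
  obtain ⟨e, he, hie, hje, hav⟩ := exists_edge_avoiding (hc i j hij) (F := univ.map c) (by
    rw [card_map, card_univ, Fintype.card_sum]
    exact Nat.le_add_right _ _)
  refine hG (contains_expandedComplete_of_core hk c ⟨{i, j}, card_pair hij⟩ he ?_
    fun i j h _ => hc i j h)
  ext z
  rw [map_insert, map_singleton, mem_inter, mem_insert, mem_singleton]
  constructor
  · exact fun h => hav z h.1 h.2
  · rintro (rfl | rfl)
    · exact ⟨hie, mem_map_of_mem c (mem_univ _)⟩
    · exact ⟨hje, mem_map_of_mem c (mem_univ _)⟩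

theorem rainbow_free {l : ℕ} (hk : 2 ≤ k) (f : V → Fin l) :
    (rainbow f k).Free (expandedComplete k (l + 1) hk) := by
  rintro ⟨φ, hφ⟩
  obtain ⟨i, j, hij, hf⟩ := Fintype.exists_ne_map_eq_of_card_lt
    (fun i : Fin (l + 1) => f (φ (Sum.inl i))) (by simp)
  let p : Pair (l + 1) := ⟨{i, j}, card_pair hij⟩
  have h1 := (mem_rainbow.1 (hφ (expandedEdge k (l + 1) p) (by simp [expandedComplete]))).2
  have h2 := h1 _ (mem_map_of_mem φ (a := Sum.inl i) (by simp [expandedEdge, p]))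
    _ (mem_map_of_mem φ (a := Sum.inl j) (by simp [expandedEdge, p])) hf
  exact hij (Sum.inl_injective (φ.injective h2))

theorem size_le_cliques_heavyGraph (N : ℕ) :
    G.size ≤ ((G.heavyGraph N).cliques k).card + Fintype.card V ^ 2 * N := by
  classical
  have h1 : G.edges ⊆ (G.heavyGraph N).cliques k ∪
      (univ.filter fun p : V × V => p.1 ≠ p.2 ∧ ¬ (G.heavyGraph N).Adj p.1 p.2).biUnion
        fun p => G.edges.filter fun e => p.1 ∈ e ∧ p.2 ∈ e := by
    intro e he
    by_cases h : (G.heavyGraph N).IsNClique k e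
    · exact mem_union_left _ ((SimpleGraph.mem_cliques _).2 h)
    · have h2 : ¬ (G.heavyGraph N).IsClique e := fun h2 => h ⟨h2, G.sized (mem_coe.2 he)⟩
      rw [SimpleGraph.isClique_iff, Set.Pairwise] at h2
      push Not at h2
      obtain ⟨x, hx, y, hy, hxy, hadj⟩ := h2
      exact mem_union_right _ (mem_biUnion.2 ⟨(x, y), by simp [hxy, hadj],
        mem_filter.2 ⟨he, hx, hy⟩⟩)
  refine (card_le_card h1).trans ((card_union_le _ _).trans (Nat.add_le_add_left ?_ _))
  refine (card_biUnion_le_card_mul _ _ N fun p hp => ?_).trans (Nat.mul_le_mul_right _ ?_)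
  · obtain ⟨h2, h3⟩ := (mem_filter.1 hp).2
    exact not_lt.1 fun h => h3 ⟨h2, h⟩
  · refine (card_le_univ _).trans ?_
    rw [Fintype.card_prod, sq]

end KGraph

end Embedding

section Exactness

open Finset

namespace SimpleGraph

open scoped Classical in
theorem filter_not_adj_le {V : Type*} [Fintype V] {l : ℕ} {Γ : SimpleGraph V} {f : V → Fin l}
    {M : ℝ} (hM : ((univ.filter fun p : V × V => f p.1 ≠ f p.2 ∧ ¬ Γ.Adj p.1 p.2).card : ℝ) ≤ M)
    {W : Fin l → Finset V} (hW : ∀ i, ∀ w ∈ W i, f w = i) {i j : Fin l} (hij : i ≠ j) :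
    (((W i ×ˢ W j).filter fun p => ¬ Γ.Adj p.1 p.2).card : ℝ) ≤ M := by
  refine le_trans ?_ hM
  refine Nat.cast_le.2 (card_le_card fun p hp => ?_)
  obtain ⟨h1, h2⟩ := mem_filter.1 hp
  obtain ⟨h3, h4⟩ := mem_product.1 h1
  exact mem_filter.2 ⟨mem_univ _, by rwa [hW i _ h3, hW j _ h4], h2⟩

open scoped Classical in
theorem not_cliqueFree_of_inner_degree {V : Type*} [Fintype V] [DecidableEq V] {l : ℕ}
    {Γ : SimpleGraph V} {f : V → Fin l} {M c : ℝ} (hM0 : 0 ≤ M) (hc : 0 < c)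
    (hM : ((univ.filter fun p : V × V => f p.1 ≠ f p.2 ∧ ¬ Γ.Adj p.1 p.2).card : ℝ) ≤ M)
    (hlt : 2 * l * M * 4 ^ l < c ^ 2) {x : V}
    (hcut : ∀ j, (univ.filter fun y => Γ.Adj x y ∧ f y = f x).card ≤
        (univ.filter fun y => Γ.Adj x y ∧ f y = j).card)
    (hx : c ≤ (univ.filter fun y => Γ.Adj x y ∧ f y = f x).card) :
    ¬ Γ.CliqueFree (l + 1) := by
  have : Nonempty V := ⟨x⟩
  let W : Fin l → Finset V := fun j => univ.filter fun y => Γ.Adj x y ∧ f y = j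
  have hWf : ∀ i, ∀ w ∈ W i, f w = i := fun i w hw => (mem_filter.1 hw).2.2
  have hWc : ∀ j, c ≤ (W j).card := fun j => hx.trans (Nat.cast_le.2 (hcut j))
  obtain ⟨w, hw, hadj⟩ := Γ.exists_adj_tuple hM0 univ W hc (fun j _ => hWc j)
    (fun i _ j _ hij => filter_not_adj_le hM hWf hij) (by simpa using hlt)
  have hw' : ∀ i, Γ.Adj x (w i) := fun i => (mem_filter.1 (hw i (mem_univ i))).2.1
  have hinj : Function.Injective w := fun i j hij => by
    by_contra hne
    exact (hadj i (mem_univ i) j (mem_univ j) hne).ne hij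
  have hQ : Γ.IsNClique l (univ.image w) := by
    refine ⟨?_, by rw [card_image_of_injective _ hinj, card_univ, Fintype.card_fin]⟩
    rintro a ha b hb hab
    obtain ⟨i, -, rfl⟩ := mem_image.1 (mem_coe.1 ha)
    obtain ⟨j, -, rfl⟩ := mem_image.1 (mem_coe.1 hb)
    exact hadj i (mem_univ i) j (mem_univ j) fun h => hab (h ▸ rfl)
  intro hfree
  refine hfree _ (hQ.insert (a := x) fun b hb => ?_)
  obtain ⟨i, -, rfl⟩ := mem_image.1 hb
  exact hw' i

end SimpleGraph

namespace KGraph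

variable {V : Type*} [Fintype V] [DecidableEq V] {k : ℕ} {G : KGraph V k}

open scoped Classical in
/-- The number of vertices in the other classes that are not adjacent to `x`. -/
noncomputable def crossNonDegree {l : ℕ} (Γ : SimpleGraph V) (f : V → Fin l) (x : V) : ℕ :=
  (univ.filter fun w => f w ≠ f x ∧ ¬ Γ.Adj x w).card

open scoped Classical in
theorem Free.le_crossNonDegree {l : ℕ} (hk : 2 ≤ k)
    (hG : G.Free (expandedComplete k (l + 1) hk)) {Γ : SimpleGraph V}
    (hΓ : Γ = G.heavyGraph
      (Fintype.card (ExpandedVertex k (l + 1)) * Fintype.card V ^ (k - 3)))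
    {f : V → Fin l} {M c : ℝ} (hM0 : 0 ≤ M) (hc : k ≤ c) (hc0 : 0 < c)
    (hM : ((univ.filter fun p : V × V => f p.1 ≠ f p.2 ∧ ¬ Γ.Adj p.1 p.2).card : ℝ) ≤ M)
    (hlt : 2 * l * M * 4 ^ l < c ^ 2)
    (hparts : ∀ i, 4 * c ≤ (univ.filter fun v => f v = i).card)
    {e : Finset V} (he : e ∈ G.edges) {x y : V} (hx : x ∈ e) (hy : y ∈ e) (hxy : x ≠ y)
    (hf : f x = f y) : c ≤ crossNonDegree Γ f x ∨ c ≤ crossNonDegree Γ f y := by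
  by_contra! hcon
  have : Nonempty V := ⟨x⟩
  let W : Fin l → Finset V := fun j => if j = f x then univ.filter fun v => f v = j else
    univ.filter fun v => f v = j ∧ Γ.Adj x v ∧ Γ.Adj y v ∧ v ∉ e
  have hWf : ∀ i, ∀ w ∈ W i, f w = i := by
    intro i w hw
    simp only [W] at hw
    split_ifs at hw
    · exact (mem_filter.1 hw).2
    · exact (mem_filter.1 hw).2.1
  have hWc : ∀ i, c ≤ (W i).card := by
    intro i
    simp only [W]
    split_ifs with hi
    · linarith [hparts i]
    · have h1 : (univ.filter fun v => f v = i) ⊆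
          (univ.filter fun v => f v = i ∧ Γ.Adj x v ∧ Γ.Adj y v ∧ v ∉ e) ∪
          ((univ.filter fun v => f v ≠ f x ∧ ¬ Γ.Adj x v) ∪
          ((univ.filter fun v => f v ≠ f y ∧ ¬ Γ.Adj y v) ∪ e)) := by
        intro v hv
        have hv' : f v = i := (mem_filter.1 hv).2
        simp only [mem_union, mem_filter, mem_univ, true_and, hv', ← hf]
        tauto
      have h2 := (card_le_card h1).trans ((card_union_le _ _).trans
        (Nat.add_le_add_left ((card_union_le _ _).trans
        (Nat.add_le_add_left (card_union_le _ _) _)) _))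
      rw [G.sized (mem_coe.2 he)] at h2
      have h3 : ((univ.filter fun v => f v = i).card : ℝ) ≤
          (univ.filter fun v => f v = i ∧ Γ.Adj x v ∧ Γ.Adj y v ∧ v ∉ e).card +
          (crossNonDegree Γ f x + (crossNonDegree Γ f y + k)) := by
        exact_mod_cast h2
      linarith [hparts i, hcon.1, hcon.2]
  obtain ⟨w, hw, hadj⟩ := Γ.exists_adj_tuple hM0 univ W hc0 (fun j _ => hWc j)
    (fun i _ j _ hij => SimpleGraph.filter_not_adj_le hM hWf hij) (by simpa using hlt)
  have hw' : ∀ j, j ≠ f x → Γ.Adj x (w j) ∧ Γ.Adj y (w j) ∧ w j ∉ e := by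
    intro j hj
    have h1 := hw j (mem_univ j)
    simp only [W, if_neg hj] at h1
    exact (mem_filter.1 h1).2.2
  let c : Fin (l + 1) → V := Fin.cons x fun j => if j = f x then y else w j
  have c0 : c 0 = x := rfl
  have cs : ∀ j, c (Fin.succ j) = if j = f x then y else w j := fun j => rfl
  let p₀ : Pair (l + 1) := ⟨{0, (f x).succ}, card_pair (Fin.succ_ne_zero _).symm⟩
  have hcadj : ∀ i j, i ≠ j → {i, j} ≠ p₀.1 → Γ.Adj (c i) (c j) := by
    intro i j hij hp
    induction i using Fin.cases with
    | zero =>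
      induction j using Fin.cases with
      | zero => exact absurd rfl hij
      | succ j =>
        have hj : j ≠ f x := by
          rintro rfl
          exact hp rfl
        rw [c0, cs, if_neg hj]
        exact (hw' j hj).1
    | succ i =>
      induction j using Fin.cases with
      | zero =>
        have hi : i ≠ f x := by
          rintro rfl
          exact hp (pair_comm _ _)
        rw [c0, cs, if_neg hi]
        exact (hw' i hi).1.symm
      | succ j =>
        have hij' : i ≠ j := fun h => hij (h ▸ rfl)
        rw [cs, cs]
        split_ifs with hi hj hj
        · exact absurd (hi.trans hj.symm) hij'
        · exact (hw' j hj).2.1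
        · exact (hw' i hi).2.1.symm
        · exact hadj i (mem_univ i) j (mem_univ j) hij'
  have hp0 : p₀.1.image c = {x, y} := by
    simp [p₀, image_insert, c0, cs]
  have hcinj : Function.Injective c := by
    intro i j hij
    by_contra hne
    by_cases hp : {i, j} = p₀.1
    · rw [← hp, image_insert, image_singleton, hij, pair_eq_singleton] at hp0
      have := congrArg card hp0
      rw [card_pair hxy, card_singleton] at this
      omega
    · exact (hcadj i j hne hp).ne hij
  refine hG (contains_expandedComplete_of_core hk ⟨c, hcinj⟩ p₀ he ?_ ?_)
  · rw [map_eq_image, map_eq_image, Function.Embedding.coeFn_mk, hp0]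
    ext z
    rw [mem_inter, mem_image, mem_insert, mem_singleton]
    constructor
    · rintro ⟨hz, i, -, rfl⟩
      induction i using Fin.cases with
      | zero => exact Or.inl rfl
      | succ i =>
        rw [cs] at hz ⊢
        split_ifs at hz ⊢ with hi
        · exact Or.inr rfl
        · exact absurd hz (hw' i hi).2.2
    · rintro (rfl | rfl)
      · exact ⟨hx, 0, mem_univ _, rfl⟩
      · exact ⟨hy, (f x).succ, mem_univ _, by rw [cs, if_pos rfl]⟩
  · intro i j hij hp
    have := hcadj i j hij hp
    rwa [hΓ] at this

theorem sum_card_filter_pairs (S : Finset (Finset V)) (hS : ∀ e ∈ S, e.card = k) :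
    ∑ x : V, ∑ w : V, (S.filter fun e => x ∈ e ∧ w ∈ e).card = k ^ 2 * S.card := by
  simp_rw [card_filter, ite_and]
  have h1 : ∀ x : V, ∑ w : V, ∑ e ∈ S, (if x ∈ e then if w ∈ e then 1 else 0 else 0) =
      ∑ e ∈ S, if x ∈ e then k else 0 := by
    intro x
    rw [sum_comm]
    refine sum_congr rfl fun e he => ?_
    split_ifs
    · rw [← card_filter]
      simp [hS e he]
    · simp
  rw [sum_congr rfl fun x _ => h1 x, sum_comm]
  rw [sum_congr rfl (g := fun _ => k ^ 2), sum_const, smul_eq_mul, mul_comm]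
  intro e he
  rw [← sum_filter, sum_const, smul_eq_mul, sq]
  simp [hS e he]

/-- A vertex with many light cross pairs lies in many missing edges. -/
theorem mul_le_sum_missing {l : ℕ} (hk : 2 ≤ k) (hkl : k ≤ l) {N : ℕ} {f : V → Fin l} {a : ℕ}
    (ha : ∀ i, a ≤ (univ.filter fun v => f v = i).card) (x : V) :
    crossNonDegree (G.heavyGraph N) f x * (a ^ (k - 2) - N) ≤
      ∑ w, (((rainbow f k).edges \ G.edges).filter fun e => x ∈ e ∧ w ∈ e).card := by
  classical
  refine le_trans ?_ (sum_le_sum_of_subset (subset_univ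
    (univ.filter fun w => f w ≠ f x ∧ ¬ (G.heavyGraph N).Adj x w)))
  have hcard : crossNonDegree (G.heavyGraph N) f x =
    (univ.filter fun w => f w ≠ f x ∧ ¬ (G.heavyGraph N).Adj x w).card := by
    unfold crossNonDegree
    congr
  rw [hcard, ← smul_eq_mul]
  refine card_nsmul_le_sum _ _ _ fun w hw => ?_
  obtain ⟨h1, h2⟩ := (mem_filter.1 hw).2
  have hxw : x ≠ w := fun h => h1 (h ▸ rfl)
  have h3 : G.codegree x w ≤ N := not_lt.1 fun h => h2 ⟨hxw, h⟩
  have h4 := le_card_rainbow_pair hk (by simpa using hkl) ha h1.symm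
  have h5 : ((rainbow f k).edges.filter fun e => x ∈ e ∧ w ∈ e) ⊆
      (((rainbow f k).edges \ G.edges).filter fun e => x ∈ e ∧ w ∈ e) ∪
      (G.edges.filter fun e => x ∈ e ∧ w ∈ e) := by
    intro e he
    rw [mem_union, mem_filter, mem_filter, mem_sdiff]
    rw [mem_filter] at he
    tauto
  have h6 := (card_le_card h5).trans (card_union_le _ _)
  rw [codegree] at h3
  omega

end KGraph

end Exactness

section Assembly

open Finset

namespace KGraph

open scoped Classical in
theorem Free.edges_subset_rainbow {V : Type*} [Fintype V] [DecidableEq V] {k l : ℕ}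
    {G : KGraph V k} (hk : 2 ≤ k) (hkl : k ≤ l)
    (hG : G.Free (expandedComplete k (l + 1) hk)) {N : ℕ}
    (hN : N = Fintype.card (ExpandedVertex k (l + 1)) * Fintype.card V ^ (k - 3))
    {f : V → Fin l} (hsize : (rainbow f k).size ≤ G.size) {M c d : ℝ} {a : ℕ}
    (hM0 : 0 ≤ M) (hkc : k ≤ c) (hd : 0 < d) (hdc : d ≤ c)
    (hM : ((univ.filter fun p : V × V =>
      f p.1 ≠ f p.2 ∧ ¬ (G.heavyGraph N).Adj p.1 p.2).card : ℝ) ≤ M)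
    (hlt : 2 * l * M * 4 ^ l < d ^ 2)
    (hcut : ∀ x j, (univ.filter fun y => (G.heavyGraph N).Adj x y ∧ f y = f x).card ≤
        (univ.filter fun y => (G.heavyGraph N).Adj x y ∧ f y = j).card)
    (hparts : ∀ i, 4 * c ≤ (univ.filter fun v => f v = i).card)
    (ha : ∀ i, a ≤ (univ.filter fun v => f v = i).card)
    (hkey : (k : ℝ) ^ 2 * (d * (Fintype.card V : ℝ) ^ (k - 2) + Fintype.card V * N) ≤
      c * ((a : ℝ) ^ (k - 2) - N)) :
    G.edges ⊆ (rainbow f k).edges := by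
  set Γ := G.heavyGraph N with hΓ
  have hc0 : 0 < c := hd.trans_le hdc
  have hfree : Γ.CliqueFree (l + 1) := by
    rw [hΓ, hN]
    exact hG.cliqueFree_heavyGraph hk (by omega)
  let A : Finset V := univ.filter fun x => c ≤ crossNonDegree Γ f x
  let B : V → Finset (Finset V) := fun x =>
    G.edges.filter fun e => x ∈ e ∧ ∃ y ∈ e, x ≠ y ∧ f x = f y
  let inner : V → ℕ := fun x => (univ.filter fun y => Γ.Adj x y ∧ f y = f x).card
  by_contra hsub
  have hbad : ∀ e ∈ G.edges, e ∉ (rainbow f k).edges → ∃ x ∈ A, e ∈ B x := by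
    intro e he heT
    rw [mem_rainbow] at heT
    push Not at heT
    obtain ⟨x, hx, y, hy, hf, hxy⟩ := heT (G.sized (mem_coe.2 he))
    rcases hG.le_crossNonDegree hk (hΓ.trans (by rw [hN])) hM0 hkc hc0 hM
      (hlt.trans_le (pow_le_pow_left₀ hd.le hdc 2)) hparts he hx hy hxy hf with h | h
    · exact ⟨x, by simpa [A] using h, mem_filter.2 ⟨he, hx, y, hy, hxy, hf⟩⟩
    · exact ⟨y, by simpa [A] using h, mem_filter.2 ⟨he, hy, x, hx, hxy.symm, hf.symm⟩⟩
  have hAne : A.Nonempty := by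
    obtain ⟨e, he, heT⟩ := not_subset.1 hsub
    obtain ⟨x, hx, -⟩ := hbad e he heT
    exact ⟨x, hx⟩
  have hmissing : ((rainbow f k).edges \ G.edges).card ≤ ∑ x ∈ A, (B x).card := by
    have h1 : (G.edges \ (rainbow f k).edges).card ≤ ∑ x ∈ A, (B x).card := by
      refine le_trans (card_le_card fun e he => ?_) card_biUnion_le
      obtain ⟨h2, h3⟩ := mem_sdiff.1 he
      obtain ⟨x, hx, hxe⟩ := hbad e h2 h3
      exact mem_biUnion.2 ⟨x, hx, hxe⟩
    refine le_trans ?_ h1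
    have h2 := card_sdiff_add_card_inter (rainbow f k).edges G.edges
    have h3 := card_sdiff_add_card_inter G.edges (rainbow f k).edges
    rw [inter_comm] at h3
    simp only [size] at hsize
    omega
  have hsum : ∑ x ∈ A, c * ((a : ℝ) ^ (k - 2) - N) ≤
      ∑ x ∈ A, (k : ℝ) ^ 2 * ((B x).card : ℝ) := by
    have h1 : ∀ x ∈ A, c * ((a : ℝ) ^ (k - 2) - N) ≤
        ((∑ w, (((rainbow f k).edges \ G.edges).filter fun e => x ∈ e ∧ w ∈ e).card : ℕ) : ℝ) := by
      intro x hx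
      have h2 : ((crossNonDegree Γ f x * (a ^ (k - 2) - N) : ℕ) : ℝ) ≤ _ :=
        Nat.cast_le.2 (mul_le_sum_missing (G := G) hk hkl (N := N) ha x)
      refine le_trans ?_ h2
      have h3 : (a : ℝ) ^ (k - 2) - N ≤ ((a ^ (k - 2) - N : ℕ) : ℝ) := by
        rw [sub_le_iff_le_add]
        exact_mod_cast Nat.sub_le_iff_le_add.1 le_rfl
      rw [Nat.cast_mul]
      exact (mul_le_mul_of_nonneg_left h3 hc0.le).trans
        (mul_le_mul_of_nonneg_right (mem_filter.1 hx).2 (Nat.cast_nonneg _))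
    refine (sum_le_sum h1).trans ?_
    rw [← Nat.cast_sum, ← mul_sum, ← Nat.cast_sum]
    have h4 : ∑ x ∈ A, ∑ w,
        (((rainbow f k).edges \ G.edges).filter fun e => x ∈ e ∧ w ∈ e).card ≤
        k ^ 2 * ∑ x ∈ A, (B x).card := by
      refine (sum_le_sum_of_subset (subset_univ A)).trans ?_
      rw [sum_card_filter_pairs _ fun e he =>
        (rainbow f k).sized (mem_coe.2 (mem_sdiff.1 he).1)]
      exact Nat.mul_le_mul_left _ hmissing
    exact_mod_cast h4
  obtain ⟨x, -, hx⟩ := exists_le_of_sum_le hAne hsum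
  have hB : (B x).card ≤ inner x * Fintype.card V ^ (k - 2) + Fintype.card V * N := by
    have h1 : B x ⊆ ((univ.filter fun y => Γ.Adj x y ∧ f y = f x).biUnion fun y =>
        G.edges.filter fun e => x ∈ e ∧ y ∈ e) ∪
        ((univ.filter fun y => x ≠ y ∧ ¬ Γ.Adj x y).biUnion fun y =>
        G.edges.filter fun e => x ∈ e ∧ y ∈ e) := by
      intro e he
      obtain ⟨he, hxe, y, hy, hxy, hf⟩ := mem_filter.1 he
      by_cases h : Γ.Adj x y
      · exact mem_union_left _ (mem_biUnion.2 ⟨y, by simp [h, hf], by simp [he, hxe, hy]⟩)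
      · exact mem_union_right _ (mem_biUnion.2 ⟨y, by simp [h, hxy], by simp [he, hxe, hy]⟩)
    refine (card_le_card h1).trans ((card_union_le _ _).trans (Nat.add_le_add ?_ ?_))
    · refine card_biUnion_le_card_mul _ _ _ fun y hy => G.codegree_le ?_
      exact (mem_filter.1 hy).2.1.ne
    · refine (card_biUnion_le_card_mul _ _ N fun y hy => ?_).trans
        (Nat.mul_le_mul_right _ (card_le_univ _))
      obtain ⟨h2, h3⟩ := (mem_filter.1 hy).2
      exact not_lt.1 fun h => h3 ⟨h2, h⟩
  have hdx : d ≤ inner x := by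
    by_contra! h
    have h1 : ((B x).card : ℝ) ≤
        inner x * (Fintype.card V : ℝ) ^ (k - 2) + Fintype.card V * N := by exact_mod_cast hB
    have hn : (0 : ℝ) < (Fintype.card V : ℝ) ^ (k - 2) := by
      have : 0 < Fintype.card V := Fintype.card_pos_iff.2 ⟨x⟩
      positivity
    have hk0 : (0 : ℝ) < (k : ℝ) ^ 2 := by
      have : 0 < k := by omega
      positivity
    have h2 := mul_lt_mul_of_pos_right h hn
    have h3 := mul_lt_mul_of_pos_left (h1.trans_lt (add_lt_add_left h2 _)) hk0
    linarith
  exact SimpleGraph.not_cliqueFree_of_inner_degree hM0 hd hM hlt (hcut x) hdx hfree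

theorem exists_le_adj_pairs {r l : ℕ} (hkl : r + 3 ≤ l) {δ : ℝ} (hδ : 0 < δ) (K : ℕ) :
    ∃ n₀ : ℕ, ∀ n, n₀ ≤ n → ∀ Γ : SimpleGraph (Fin n), Γ.CliqueFree (l + 1) →
      l.choose (r + 3) * (n / l) ^ (r + 3) ≤ (Γ.cliques (r + 3)).card + n ^ 2 * (K * n ^ r) →
      (1 - 1 / l - δ) * (n : ℝ) ^ 2 ≤ (2 * (Γ.cliques 2).card : ℕ) := by
  set C : ℝ := (l.choose (r + 3) : ℝ) with hC
  have hC1 : 1 ≤ C := Nat.one_le_cast.2 (Nat.choose_pos hkl)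
  have hl : (3 : ℝ) ≤ l := by exact_mod_cast (show 3 ≤ l by omega)
  set Q : ℝ := C * ((r + 3) * l) + (l : ℝ) ^ (r + 3) * K with hQ
  obtain ⟨n₀, hn₀⟩ := exists_nat_ge (Q / δ)
  refine ⟨max n₀ l, fun n hn Γ hΓ hcl => ?_⟩
  have hnl : (l : ℝ) ≤ n := by exact_mod_cast (le_max_right _ _).trans hn
  have hn0 : (0 : ℝ) < n := by linarith
  have hnQ : Q ≤ δ * n := by
    rw [div_le_iff₀ hδ] at hn₀
    have : (n₀ : ℝ) ≤ n := by exact_mod_cast (le_max_left _ _).trans hn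
    nlinarith
  have h1 := SimpleGraph.card_cliques_le_card_edges hΓ (r := r + 1) (by omega)
  rw [Fintype.card_fin] at h1
  change ((Γ.cliques (r + 3)).card : ℝ) * _ * _ ≤ C * _ * _ at h1
  have hch : (2 : ℝ) * l.choose 2 = l * (l - 1) := by
    have h2 := Nat.cast_choose_two ℝ l
    rw [h2]
    ring
  have hcl' : C * ((n / l : ℕ) : ℝ) ^ (r + 3) ≤
      (Γ.cliques (r + 3)).card + (K : ℝ) * n ^ (r + 2) := by
    have : C * ((n / l : ℕ) : ℝ) ^ (r + 3) ≤
      (Γ.cliques (r + 3)).card + (n : ℝ) ^ 2 * (K * n ^ r) := by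
      rw [hC]
      exact_mod_cast hcl
    refine this.trans (le_of_eq ?_)
    ring
  have hdiv : (n : ℝ) - l ≤ l * ((n / l : ℕ) : ℝ) := by
    have h2 := Nat.lt_mul_div_succ n (show 0 < l by omega)
    have h3 : (n : ℝ) < l * (((n / l : ℕ) : ℝ) + 1) := by exact_mod_cast h2
    linarith
  have hbern : (n : ℝ) ^ (r + 3) - (r + 3) * l * n ^ (r + 2) ≤
      (l : ℝ) ^ (r + 3) * ((n / l : ℕ) : ℝ) ^ (r + 3) := by
    have h2 := one_add_mul_le_pow (a := -(l / n : ℝ)) (by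
      have : (l / n : ℝ) ≤ 1 := by rwa [div_le_one hn0]
      linarith) (r + 3)
    have h3 : (n : ℝ) ^ (r + 3) * (1 + -(l / n)) ^ (r + 3) = (n - l) ^ (r + 3) := by
      rw [← mul_pow]
      congr 1
      field_simp
      ring
    have h4 := mul_le_mul_of_nonneg_left h2 (pow_pos hn0 (r + 3)).le
    rw [h3] at h4
    rw [← mul_pow]
    refine le_trans (le_of_eq ?_) (h4.trans (pow_le_pow_left₀ (by linarith) hdiv _))
    push_cast
    field_simp
    ring
  generalize ((n / l : ℕ) : ℝ) = q at *
  generalize ((Γ.cliques (r + 3)).card : ℝ) = s at *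
  push_cast
  generalize ((Γ.cliques 2).card : ℝ) = e at *
  have hl0 : (0 : ℝ) < l := by linarith
  have hs : C * ((n : ℝ) ^ (r + 3) - (r + 3) * l * n ^ (r + 2)) ≤
      l ^ (r + 3) * s + l ^ (r + 3) * K * n ^ (r + 2) := by
    have h2 := mul_le_mul_of_nonneg_left hbern (by linarith : 0 ≤ C)
    have h3 := mul_le_mul_of_nonneg_left hcl' (pow_pos hl0 (r + 3)).le
    linarith
  have hs' : (C - δ) * n ^ (r + 3) ≤ l ^ (r + 3) * s := by
    have h2 := mul_le_mul_of_nonneg_right hnQ (pow_pos hn0 (r + 2)).le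
    rw [hQ] at h2
    rw [pow_succ (n : ℝ) (r + 2)] at hs ⊢
    linarith
  have he : l ^ (r + 3) * s * (l - 1) ≤ l * (C * n ^ (r + 1) * (2 * e)) := by
    have h2 := mul_le_mul_of_nonneg_left h1 (by linarith : (0 : ℝ) ≤ 2 * l)
    calc _ = 2 * l * (s * ((l * (l - 1)) / 2) * l ^ (r + 1)) := by ring
      _ = 2 * l * (s * l.choose 2 * l ^ (r + 1)) := by rw [← hch]; ring
      _ ≤ _ := h2
      _ = _ := by ring
  have h5 : (C - δ) * n ^ (r + 3) * (l - 1) ≤ l * (C * n ^ (r + 1) * (2 * e)) :=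
    (mul_le_mul_of_nonneg_right hs' (by linarith)).trans he
  have hp : 0 < l * C * (n : ℝ) ^ (r + 1) := by positivity
  refine le_of_mul_le_mul_left ?_ hp
  refine le_trans ?_ (h5.trans (le_of_eq (by ring)))
  have h6 : l * C * (n : ℝ) ^ (r + 1) * ((1 - 1 / l - δ) * n ^ 2) =
      (C * (l - 1) - C * l * δ) * n ^ (r + 3) := by
    field_simp
    ring
  rw [h6]
  have h7 : C * (l - 1) - C * l * δ ≤ (C - δ) * (l - 1) := by
    nlinarith [mul_le_mul_of_nonneg_right hC1 (mul_pos hl0 hδ).le]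
  exact (mul_le_mul_of_nonneg_right h7 (pow_pos hn0 _).le).trans (le_of_eq (by ring))

open scoped Classical in
theorem exists_structured_partition {r l : ℕ} (hk : 2 ≤ r + 3) (hkl : r + 3 ≤ l) {ε : ℝ}
    (hε : 0 < ε) :
    ∃ n₀ : ℕ, ∀ n, n₀ ≤ n → ∀ G : KGraph (Fin n) (r + 3), ∀ N : ℕ,
      N = Fintype.card (ExpandedVertex (r + 3) (l + 1)) * n ^ r →
      G.Free (expandedComplete (r + 3) (l + 1) hk) → (turan (r + 3) n l).size ≤ G.size →
      ∃ f : Fin n → Fin l,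
        ((univ.filter fun p : Fin n × Fin n =>
          f p.1 ≠ f p.2 ∧ ¬ (G.heavyGraph N).Adj p.1 p.2).card : ℝ) ≤ ε * n ^ 2 ∧
        (∀ i, (n : ℝ) / (2 * l) ≤ (univ.filter fun v => f v = i).card) ∧
        ∀ x j, (univ.filter fun y => (G.heavyGraph N).Adj x y ∧ f y = f x).card ≤
          (univ.filter fun y => (G.heavyGraph N).Adj x y ∧ f y = j).card := by
  have hl : (0 : ℝ) < l := by exact_mod_cast (show 0 < l by omega)
  set δ : ℝ := min (ε / 2) (1 / (8 * l ^ 2)) with hδdef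
  have hδ : 0 < δ := lt_min (by positivity) (by positivity)
  obtain ⟨n₀, hn₀⟩ := exists_le_adj_pairs hkl hδ (Fintype.card (ExpandedVertex (r + 3) (l + 1)))
  refine ⟨n₀, fun n hn G N hN hG hsize => ?_⟩
  have hfree : (G.heavyGraph N).CliqueFree (l + 1) := by
    have := hG.cliqueFree_heavyGraph hk (by omega)
    rw [Fintype.card_fin] at this
    rw [hN]
    exact this
  have h1 := hn₀ n hn (G.heavyGraph N) hfree (by
    rw [← hN]
    refine (le_size_turan (by omega) _).trans (hsize.trans ?_)
    have := G.size_le_cliques_heavyGraph N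
    rwa [Fintype.card_fin] at this)
  rw [← SimpleGraph.card_adj_pairs] at h1
  obtain ⟨f, hf1, hf2, hf3⟩ := SimpleGraph.exists_max_cut (Γ := G.heavyGraph N) (l := l)
    (δ := δ) (by omega) hfree (by rw [Fintype.card_fin]; exact h1)
  simp only [Fintype.card_fin] at hf1 hf2
  have hn2 : (0 : ℝ) ≤ (n : ℝ) ^ 2 := by positivity
  refine ⟨f, hf1.trans (mul_le_mul_of_nonneg_right ?_ hn2), fun i => ?_, hf3⟩
  · have : δ ≤ ε / 2 := min_le_left _ _
    linarith
  · have h2 : 2 * δ * (n : ℝ) ^ 2 ≤ (n / (2 * l)) ^ 2 := by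
      have h3 : δ ≤ 1 / (8 * l ^ 2) := min_le_right _ _
      calc 2 * δ * (n : ℝ) ^ 2 ≤ 2 * (1 / (8 * l ^ 2)) * n ^ 2 := by gcongr
        _ = ((n : ℝ) / (2 * l)) ^ 2 := by
          field_simp
          ring
    have h4 := abs_le_of_sq_le_sq' ((hf2 i).trans h2) (by positivity)
    have h5 : (n : ℝ) / l = n / (2 * l) + n / (2 * l) := by
      field_simp
      ring
    linarith [h4.1]

theorem exists_edges_subset_rainbow {k l : ℕ} (hk : 3 ≤ k) (hkl : k ≤ l) :
    ∃ n₀ : ℕ, ∀ n, n₀ ≤ n → ∀ G : KGraph (Fin n) k,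
      G.Free (expandedComplete k (l + 1) (le_trans (Nat.le_succ 2) hk)) →
      (turan k n l).size ≤ G.size → ∃ f : Fin n → Fin l, G.edges ⊆ (rainbow f k).edges := by
  obtain ⟨r, rfl⟩ := Nat.exists_eq_add_of_le' hk
  have hl : (3 : ℝ) ≤ l := by exact_mod_cast (show 3 ≤ l by omega)
  have hl0 : (0 : ℝ) < l := by linarith
  set K := Fintype.card (ExpandedVertex (r + 3) (l + 1)) with hK
  set β : ℝ := 1 / (8 * l) * (1 / (2 * l)) ^ (r + 1) with hβ
  have hβ0 : 0 < β := by positivity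
  have hβ1 : β ≤ 1 / (8 * l) := by
    refine mul_le_of_le_one_right (by positivity) (pow_le_one₀ (by positivity) ?_)
    rw [div_le_one (by positivity)]
    linarith
  set κ : ℝ := ((r + 3 : ℕ) : ℝ) ^ 2 with hκ
  have hκ1 : 1 ≤ κ := one_le_pow₀ (by norm_cast; omega)
  set γ : ℝ := β / (2 * κ) with hγ
  have hγ0 : 0 < γ := by positivity
  have hγ1 : γ ≤ 1 / (8 * l) := (div_le_self hβ0.le (by linarith)).trans hβ1
  set ε : ℝ := γ ^ 2 / (4 * l * 4 ^ l) with hε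
  have hε0 : 0 < ε := by positivity
  obtain ⟨n₁, hn₁⟩ := exists_structured_partition (le_trans (Nat.le_succ 2) hk) hkl hε0
  obtain ⟨n₂, hn₂⟩ := exists_nat_ge (8 * l * (r + 3) : ℝ)
  obtain ⟨n₃, hn₃⟩ := exists_nat_ge (2 * (κ + 1) * K / β)
  refine ⟨max n₁ (max n₂ (max n₃ l)), fun n hn G hG hsize => ?_⟩
  simp only [max_le_iff] at hn
  obtain ⟨f, hf1, hf2, hf3⟩ := hn₁ n hn.1 G _ rfl hG hsize
  have hnl : (l : ℝ) ≤ n := by exact_mod_cast hn.2.2.2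
  have hn0 : (0 : ℝ) < n := by linarith
  have hn2' : 8 * l * (r + 3) ≤ (n : ℝ) := hn₂.trans (by exact_mod_cast hn.2.1)
  have hn3' : 2 * (κ + 1) * K ≤ n * β := by
    rw [div_le_iff₀ hβ0] at hn₃
    refine hn₃.trans (mul_le_mul_of_nonneg_right ?_ hβ0.le)
    exact_mod_cast hn.2.2.1
  refine ⟨f, hG.edges_subset_rainbow (le_trans (Nat.le_succ 2) hk) hkl
    (N := K * n ^ r) (by simp [K]) (M := ε * n ^ 2)
    (c := n / (8 * l)) (d := γ * n) (a := ⌈(n : ℝ) / (2 * l)⌉₊)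
    ((exists_size_rainbow_le_turan (by omega) hkl hn.2.2.2 f).1.trans hsize)
    (by positivity) ?_ (by positivity) ?_ hf1 ?_ hf3 ?_ (fun i => Nat.ceil_le.2 (hf2 i)) ?_⟩
  · rw [le_div_iff₀ (by positivity)]
    push_cast
    linarith
  · calc γ * n ≤ 1 / (8 * l) * n := mul_le_mul_of_nonneg_right hγ1 hn0.le
      _ = n / (8 * l) := by ring
  · have h1 : 2 * l * (ε * n ^ 2) * 4 ^ l = (γ * n) ^ 2 / 2 := by
      rw [hε]
      field_simp
      ring
    rw [h1]
    exact half_lt_self (by positivity)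
  · intro i
    refine le_trans (le_of_eq ?_) (hf2 i)
    field_simp
    ring
  · rw [Fintype.card_fin]
    simp only [show r + 3 - 2 = r + 1 by omega]
    have h1 : ((n : ℝ) / (2 * l)) ^ (r + 1) ≤ (⌈(n : ℝ) / (2 * l)⌉₊ : ℝ) ^ (r + 1) :=
      pow_le_pow_left₀ (by positivity) (Nat.le_ceil _) _
    have h2 : (n : ℝ) / (8 * l) * (n / (2 * l)) ^ (r + 1) = β * n ^ (r + 2) := by
      rw [hβ, div_pow, div_pow, one_pow]
      field_simp
      ring
    have h3 : (n : ℝ) / (8 * l) * (K * n ^ r) ≤ K * n ^ (r + 1) := by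
      have h4 : (n : ℝ) / (8 * l) ≤ n := div_le_self hn0.le (by linarith)
      calc (n : ℝ) / (8 * l) * (K * n ^ r) ≤ n * (K * n ^ r) := by gcongr
        _ = K * n ^ (r + 1) := by ring
    have h5 : κ * γ = β / 2 := by
      rw [hγ]
      field_simp
    have h6 := mul_le_mul_of_nonneg_right hn3' (pow_pos hn0 (r + 1)).le
    have h7 := mul_le_mul_of_nonneg_left h1 (show (0 : ℝ) ≤ n / (8 * l) by positivity)
    push_cast
    rw [mul_sub]
    have h8 : (κ * (γ * n * n ^ (r + 1) + n * (K * n ^ r)) : ℝ) =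
        κ * γ * n ^ (r + 2) + κ * K * n ^ (r + 1) := by ring
    have h9 : n * β * (n : ℝ) ^ (r + 1) = β * n ^ (r + 2) := by ring
    have h10 : ((r : ℝ) + 3) ^ 2 = κ := by
      rw [hκ]
      push_cast
      rfl
    rw [h10, h8, h5]
    linarith

end KGraph

end Assembly

theorem theorem2 (k l : ℕ) (hk : 3 ≤ k) (hl : k ≤ l) :
    ∃ n₀ : ℕ, ∀ n : ℕ, n₀ ≤ n →
      KGraph.ex n (KGraph.expandedComplete k (l + 1) (le_trans (Nat.le_succ 2) hk))
          = (KGraph.turan k n l).size ∧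
      ∀ G : KGraph (Fin n) k,
        G.IsMaximumFree (KGraph.expandedComplete k (l + 1) (le_trans (Nat.le_succ 2) hk)) ↔
          G.Isomorphic (KGraph.turan k n l) := by
  obtain ⟨n₀, hn₀⟩ := KGraph.exists_edges_subset_rainbow hk hl
  refine ⟨max n₀ l, fun n hn => ?_⟩
  rw [max_le_iff] at hn
  have hk2 : 2 ≤ k := le_trans (Nat.le_succ 2) hk
  set H := KGraph.expandedComplete k (l + 1) (le_trans (Nat.le_succ 2) hk) with hH
  have hTfree : (KGraph.turan k n l).Free H := by
    have h := KGraph.rainbow_free (k := k) hk2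
      (fun x : Fin n => (⟨x.val % l, Nat.mod_lt _ (by omega)⟩ : Fin l))
    rintro ⟨φ, hφ⟩
    exact h ⟨φ, fun e he => by
      rw [← KGraph.turan_edges_eq_rainbow (by omega)]
      exact hφ e he⟩
  have hextremal : ∀ G : KGraph (Fin n) k, G.Free H →
      (KGraph.turan k n l).size ≤ G.size → G.Isomorphic (KGraph.turan k n l) := by
    intro G hG hsize
    obtain ⟨f, hf⟩ := hn₀ n hn.1 G hG hsize
    have hle : G.size ≤ (KGraph.rainbow f k).size := Finset.card_le_card hf
    obtain ⟨h1, h2⟩ := KGraph.exists_size_rainbow_le_turan hk2 hl hn.2 f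
    have heq : G.edges = (KGraph.rainbow f k).edges :=
      Finset.eq_of_subset_of_card_le hf (h1.trans hsize)
    obtain ⟨σ, hσ⟩ := h2 (hsize.trans hle)
    exact ⟨σ, fun e => by rw [heq]; exact hσ e⟩
  have hmax : ∀ G : KGraph (Fin n) k, G.Free H → G.size ≤ (KGraph.turan k n l).size := by
    intro G hG
    by_contra! hlt
    exact hlt.ne' (hextremal G hG hlt.le).size_eq
  refine ⟨?_, fun G => ⟨fun hG => hextremal G hG.1 (hG.2 _ hTfree), fun hG => ⟨?_, ?_⟩⟩⟩
  · refine IsGreatest.csSup_eq ⟨⟨_, hTfree, rfl⟩, ?_⟩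
    rintro _ ⟨G, hG, rfl⟩
    exact hmax G hG
  · exact fun hc => hTfree (hG.contains hc)
  · intro G' hG'
    rw [hG.size_eq]
    exact hmax G' hG'
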